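/- **Conventions.** Write $x^\perp=(-x_2,x_1)$ for $x\in\mathbb R^2$. Let $\mu>0$ and let $\mathbf e_1,\mathbf e_2\in\mathbb R^2$ be positively oriented, $\det(\mathbf e_1,\mathbf e_2)>0$. Write points as $x=a\,\mathbf e_1+b\,\mathbf e_2$. The unit cell is $\mathcal U=\{|a|,|b|\le\frac12\}$ and the expanded cell is $\tilde{\mathcal U}=\{-1\le a,b<1\}$. The walls $D=\{b=-\frac12,|a|\le\frac12\}$, $L=\{a=-\frac12,|b|\le\frac12\}$, $R=L+\mathbf e_1$ and their translates are directed along $\mathbf e_1$ (for $D$) and $\mathbf e_2$ (for $L$, $R$). On every directed curve with unit tangent $\mathbf t$ tractions are taken with respect to the unit normal $\mathbf n=\mathbf t^\perp$. For a velocity–pressure pair, $\mathbf T(\mathbf v,q)_i=\sum_j\big(-\delta_{ij}q+\mu(\partial_jv_i+\partial_iv_j)\big)n_j$. With $r=x-y$, the Stokeslet is $G_{ij}(x,y)=\frac1{4\pi\mu}\big(\delta_{ij}\log\frac1{|r|}+\frac{r_ir_j}{|r|^2}\big)$, and for a curve $\Gamma$ with density $\boldsymbol\sigma$ the free-space single-layer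 traction is $$S^t_\Gamma[\boldsymbol\sigma](x)=\int_\Gamma G^t(x,y)\boldsymbol\sigma(y)\,ds_y,\qquad G^t_{ik}(x,y)=-\frac1\pi\frac{r_ir_k}{|r|^2}\frac{r\cdot\mathbf n_x}{|r|^2}.$$ The near sums $S^{near}_\Gamma[\boldsymbol\sigma]$ (velocity) and $S^{near,t}_\Gamma[\boldsymbol\sigma]$ (traction) are obtained by replacing $G(x,y)$, $G^t(x,y)$ by the sums of $G(x,y+m\mathbf e_1+k\mathbf e_2)$, $G^t(x,y+m\mathbf e_1+k\mathbf e_2)$ over the $(m,k)\in\mathbb Z^2$ with $y+m\mathbf e_1+k\mathbf e_2\in\tilde{\mathcal U}$. **Setting.** Let $\Omega$ be a bounded domain with $\overline\Omega\subset\tilde{\mathcal U}$ whose boundary $\Gamma$ is one smooth simple closed curve and whose closure is disjoint from all its translates by non-zero lattice vectors; $\Omega$ may cut the bottom wall $D$. Let $\boldsymbol\sigma$ be a continuous density on $\Gamma$ and $\mathbf F=\int_\Gamma\boldsymbol\sigma\,ds$. Let $(\mathbf v,q)$ be a correction pair: a smooth solution of $-\mu\Delta\mathbf v+\nabla q=0$,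 $\nabla\cdot\mathbf v=0$ in an open convex set $W$ with $\mathcal U\subset W\subset\tilde{\mathcal U}$, such that $S^{near}_\Gamma[\boldsymbol\sigma]+\mathbf v$ takes equal values at corresponding points of opposite walls of $\mathcal U$, and such that $S^{near,t}_\Gamma[\boldsymbol\sigma]+\mathbf T(\mathbf v,q)$, taken with the normals pointing out of $\mathcal U$ at $R$ and at the top wall $U=D+\mathbf e_2$, has the jumps $-\mathbf F/(2|\mathbf e_2|)$ from $L$ to $R$ and $-\mathbf F/(2|\mathbf e_1|)$ from $D$ to $U$ (at wall points not on lattice translates of $\Gamma$). Let $\mathbf T=S^{per,t}_\Gamma[\boldsymbol\sigma]=S^{near,t}_\Gamma[\boldsymbol\sigma]+\mathbf T(\mathbf v,q)$ be the traction of the periodic single-layer potential. Let $\mathcal C\subset W$ be a piecewise $C^1$ curve of finite length with the same initial and final point as $D$, which touches no lattice translate of $\overline\Omega$ and passes below $\Omega$: for the periodic curve $\bigcup_{m\in\mathbb Z}(\mathcal C+m\mathbf e_1)$, the sets $\overline\Omega+k\mathbf e_2$ lie above it for integers $k\ge0$ and below it for $k<0$ (that is, each of their points can be joined, without meeting the periodic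 curve, to a point whose coordinate $b$ is larger, respectively smaller, than on the whole periodic curve). Let $\Gamma_1,\dots,\Gamma_4$ be the parts of $\Gamma$ in the quadrants $\{a\ge0,b\ge0\}$, $\{a<0,b\ge0\}$, $\{a<0,b<0\}$, $\{a\ge0,b<0\}$; put $\tilde\Gamma_1=\Gamma_1-\mathbf e_1-\mathbf e_2$, $\tilde\Gamma_2=\Gamma_2-\mathbf e_2$, $\tilde\Gamma_3=\Gamma_3$, $\tilde\Gamma_4=\Gamma_4-\mathbf e_1$, $\tilde\Gamma=\bigcup_i\tilde\Gamma_i$, and let $\tilde{\boldsymbol\sigma}$ on $\tilde\Gamma$ be the density $\boldsymbol\sigma$ carried along with the pieces. **Proposition.** Then $$\begin{aligned}\int_{\mathcal C}\mathbf T\,ds=&\int_{R-\mathbf e_2}S^t_{\tilde\Gamma}[\tilde{\boldsymbol\sigma}]\,ds-\int_{L-\mathbf e_1-\mathbf e_2}S^t_{\tilde\Gamma}[\tilde{\boldsymbol\sigma}]\,ds+2\int_{D-\mathbf e_1-\mathbf e_2}S^t_{\tilde\Gamma}[\tilde{\boldsymbol\sigma}]\,ds+2\int_{D-\mathbf e_2}S^t_{\tilde\Gamma}[\tilde{\boldsymbol\sigma}]\,ds\\&-\int_{\Gamma_1\cup\Gamma_2}\boldsymbol\sigma\,ds+\int_D\mathbf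 T(\mathbf v,q)\,ds.\end{aligned}$$ Moreover the sources and targets on the right are well separated: for every $x$ on one of the four shifted walls $R-\mathbf e_2$, $L-\mathbf e_1-\mathbf e_2$, $D-\mathbf e_1-\mathbf e_2$, $D-\mathbf e_2$ and every $y\in\tilde\Gamma$, one of the two coordinates of $x-y$ in the basis $(\mathbf e_1,\mathbf e_2)$ has absolute value at least $\frac12$. -/

import Mathlib

open MeasureTheory Set
open scoped ContDiff InnerProductSpace Laplacian Gradient

noncomputable section

namespace StokesCell

/-- The Euclidean plane. -/
abbrev Plane : Type := EuclideanSpace ℝ (Fin 2)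

/-- Rotation by a right angle counterclockwise, `x^⊥ = (-x₂, x₁)`. -/
def perp (x : Plane) : Plane := !₂[-(x 1), x 0]

/-- The determinant of the pair `(x, y)`. -/
def cross (x y : Plane) : ℝ := x 0 * y 1 - x 1 * y 0

/-! ### The skew unit cell centred at the origin -/

/-- The `e₁`-coordinate of `x` in the basis `(e₁, e₂)`. -/
def coordA (e₁ e₂ x : Plane) : ℝ := cross x e₂ / cross e₁ e₂

/-- The `e₂`-coordinate of `x` in the basis `(e₁, e₂)`. -/
def coordB (e₁ e₂ x : Plane) : ℝ := cross e₁ x / cross e₁ e₂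

/-- The closed unit cell. -/
def cell (e₁ e₂ : Plane) : Set Plane :=
  {x | |coordA e₁ e₂ x| ≤ 1 / 2 ∧ |coordB e₁ e₂ x| ≤ 1 / 2}

/-- The expanded cell: same centre, walls parallel to those of the unit cell and twice as long.
It is taken half-open, so that it contains exactly four lattice translates of every point. -/
def expandedCell (e₁ e₂ : Plane) : Set Plane :=
  {x | coordA e₁ e₂ x ∈ Ico (-1 : ℝ) 1 ∧ coordB e₁ e₂ x ∈ Ico (-1 : ℝ) 1}

/-- The lower left corner of the unit cell. -/
def corner (e₁ e₂ : Plane) : Plane := -((1 / 2 : ℝ) • (e₁ + e₂))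

/-- The segment from `a` to `a + d`, as a curve parametrized by `[0, 1]`. -/
def seg (a d : Plane) : ℝ → Plane := fun t => a + t • d

/-- The left wall, directed along `e₂`. -/
def wallL (e₁ e₂ : Plane) : ℝ → Plane := seg (corner e₁ e₂) e₂

/-- The right wall, directed along `e₂`. -/
def wallR (e₁ e₂ : Plane) : ℝ → Plane := seg (corner e₁ e₂ + e₁) e₂

/-- The bottom wall, directed along `e₁`. -/
def wallD (e₁ e₂ : Plane) : ℝ → Plane := seg (corner e₁ e₂) e₁

/-- The translate `c - a` of a parametrized curve. -/
def shiftCurve (c : ℝ → Plane) (a : Plane) : ℝ → Plane := fun t => c t - a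

/-! ### Curves and line integrals of tractions -/

/-- A piecewise `C¹` curve of finite length, parametrized by `[0, 1]`. -/
def IsPiecewiseC1 (c : ℝ → Plane) : Prop :=
  ContinuousOn c (Icc 0 1) ∧
  (∃ P : Set ℝ, P.Finite ∧ ∀ t ∈ Ioo (0 : ℝ) 1 \ P, ContDiffAt ℝ 1 c t) ∧
  IntervalIntegrable (deriv c) volume 0 1

/-- The unit normal of a directed curve: the unit tangent rotated counterclockwise. -/
def unitNormal (c : ℝ → Plane) (t : ℝ) : Plane := perp (‖deriv c t‖⁻¹ • deriv c t)

/-- `∫_c T ds`, for a traction `T x n` at the point `x` with respect to the normal `n`. -/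
def tractionIntegral (c : ℝ → Plane) (T : Plane → Plane → Plane) : Plane :=
  ∫ t in (0 : ℝ)..1, ‖deriv c t‖ • T (c t) (unitNormal c t)

/-! ### Stokes pairs -/

/-- The partial derivative `∂ⱼ uᵢ`. -/
def pderiv (u : Plane → Plane) (j i : Fin 2) (x : Plane) : ℝ :=
  fderiv ℝ u x (EuclideanSpace.single j 1) i

/-- The stress tensor `σᵢⱼ(u, p) = -δᵢⱼ p + μ (∂ⱼuᵢ + ∂ᵢuⱼ)`. -/
def stress (μ : ℝ) (u : Plane → Plane) (p : Plane → ℝ) (x : Plane) : Matrix (Fin 2) (Fin 2) ℝ :=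
  Matrix.of fun i j => (if i = j then -p x else 0) + μ * (pderiv u j i x + pderiv u i j x)

/-- The traction `T(u, p) = σ(u, p) n`. -/
def traction (μ : ℝ) (u : Plane → Plane) (p : Plane → ℝ) (x n : Plane) : Plane :=
  WithLp.toLp 2 fun i => ∑ j, stress μ u p x i j * n j

/-- `(u, p)` is a smooth solution of `-μ Δu + ∇p = 0`, `∇ · u = 0` in the open set `W`. -/
def IsStokesPair (μ : ℝ) (W : Set Plane) (u : Plane → Plane) (p : Plane → ℝ) : Prop :=
  ContDiffOn ℝ ∞ u W ∧ ContDiffOn ℝ ∞ p W ∧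
  ∀ x ∈ W, -(μ • Δ u x) + ∇ p x = 0 ∧ ∑ i, pderiv u i i x = 0

/-! ### Free-space kernels and layer potentials -/

/-- The Stokeslet `G(x, y) f`, where
`Gᵢⱼ(x, y) = (1 / 4πμ) (δᵢⱼ log (1 / |r|) + rᵢ rⱼ / |r|²)` and `r = x - y`. -/
def stokeslet (μ : ℝ) (x y f : Plane) : Plane :=
  (1 / (4 * Real.pi * μ)) •
    (Real.log (1 / ‖x - y‖) • f + (⟪x - y, f⟫_ℝ / ‖x - y‖ ^ 2) • (x - y))

/-- The single-layer traction kernel `Gᵗ(x, y) f` for the normal `n` at the target `x`, where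
`Gᵗᵢₖ(x, y) = -(1 / π) (rᵢ rₖ / |r|²) (r · n / |r|²)` and `r = x - y`. -/
def tractionKernel (x n y f : Plane) : Plane :=
  (-(1 / Real.pi) * (⟪x - y, f⟫_ℝ / ‖x - y‖ ^ 2) * (⟪x - y, n⟫_ℝ / ‖x - y‖ ^ 2)) • (x - y)

/-- `Sᵗ_Γ[σ](x) = ∫_Γ Gᵗ(x, y) σ(y) ds_y`; arc length is one-dimensional Hausdorff measure. -/
def singleLayerTraction (Γ : Set Plane) (σ : Plane → Plane) (x n : Plane) : Plane :=
  ∫ y in Γ, tractionKernel x n y (σ y) ∂μH[1]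

/-- The net force `∫_Γ σ ds`. -/
def netForce (Γ : Set Plane) (σ : Plane → Plane) : Plane := ∫ y in Γ, σ y ∂μH[1]

/-- The lattice vector `m e₁ + k e₂`. -/
def latticeVec (e₁ e₂ : Plane) (m k : ℤ) : Plane := (m : ℝ) • e₁ + (k : ℝ) • e₂

/-- The sum of a kernel over the lattice images of the source that lie in the expanded cell. -/
def nearSum (e₁ e₂ : Plane) (K : Plane → Plane) (y : Plane) : Plane :=
  ∑ᶠ (k : ℤ × ℤ) (_ : y + latticeVec e₁ e₂ k.1 k.2 ∈ expandedCell e₁ e₂),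
    K (y + latticeVec e₁ e₂ k.1 k.2)

/-- The near part of the single-layer velocity. -/
def nearVelocity (μ : ℝ) (e₁ e₂ : Plane) (Γ : Set Plane) (σ : Plane → Plane) (x : Plane) : Plane :=
  ∫ y in Γ, nearSum e₁ e₂ (fun z => stokeslet μ x z (σ y)) y ∂μH[1]

/-- The near part of the single-layer traction. -/
def nearTraction (e₁ e₂ : Plane) (Γ : Set Plane) (σ : Plane → Plane) (x n : Plane) : Plane :=
  ∫ y in Γ, nearSum e₁ e₂ (fun z => tractionKernel x n z (σ y)) y ∂μH[1]

/-- The point `x` lies on no lattice image of `Γ`. -/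
def OffLattice (e₁ e₂ : Plane) (Γ : Set Plane) (x : Plane) : Prop :=
  ∀ m k : ℤ, x + latticeVec e₁ e₂ m k ∉ Γ

/-- `(v, q)` is a correction pair of the periodic single-layer potential on `Γ` with density `σ`:
a Stokes pair in the neighbourhood `W` of the cell, without sources, whose discrepancies between
opposite walls turn the near sum into a velocity without jumps and a traction whose jump across
each pair of opposite walls is constant and carries one half of the net force `F = ∫_Γ σ ds`.
The jumps are those of the tractions for the normals that point out of the cell at the right wall
(`-e₂^⊥/|e₂|`) and at the top wall (`e₁^⊥/|e₁|`), so that the total outward traction is `-F`.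
Wall points that lie on images of `Γ` (where the single-layer traction has no value) are skipped. -/
structure IsCorrectionPair (μ : ℝ) (e₁ e₂ : Plane) (Γ : Set Plane) (σ : Plane → Plane)
    (W : Set Plane) (v : Plane → Plane) (q : Plane → ℝ) : Prop where
  stokes : IsStokesPair μ W v q
  velocity_RL : ∀ t ∈ Icc (0 : ℝ) 1, ∀ x, x = wallL e₁ e₂ t → OffLattice e₁ e₂ Γ x →
    v (x + e₁) - v x = -(nearVelocity μ e₁ e₂ Γ σ (x + e₁) - nearVelocity μ e₁ e₂ Γ σ x)
  traction_RL : ∀ t ∈ Icc (0 : ℝ) 1, ∀ x, x = wallL e₁ e₂ t → OffLattice e₁ e₂ Γ x →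
    ∀ n, n = -(‖e₂‖⁻¹ • perp e₂) →
    traction μ v q (x + e₁) n - traction μ v q x n =
      -(nearTraction e₁ e₂ Γ σ (x + e₁) n - nearTraction e₁ e₂ Γ σ x n)
        - (1 / (2 * ‖e₂‖)) • netForce Γ σ
  velocity_UD : ∀ t ∈ Icc (0 : ℝ) 1, ∀ x, x = wallD e₁ e₂ t → OffLattice e₁ e₂ Γ x →
    v (x + e₂) - v x = -(nearVelocity μ e₁ e₂ Γ σ (x + e₂) - nearVelocity μ e₁ e₂ Γ σ x)
  traction_UD : ∀ t ∈ Icc (0 : ℝ) 1, ∀ x, x = wallD e₁ e₂ t → OffLattice e₁ e₂ Γ x →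
    ∀ n, n = ‖e₁‖⁻¹ • perp e₁ →
    traction μ v q (x + e₂) n - traction μ v q x n =
      -(nearTraction e₁ e₂ Γ σ (x + e₂) n - nearTraction e₁ e₂ Γ σ x n)
        - (1 / (2 * ‖e₁‖)) • netForce Γ σ

/-- The traction `Sᵖᵉʳ'ᵗ_Γ[σ] = Sⁿᵉᵃʳ'ᵗ_Γ[σ] + T(v, q)` of the periodic single-layer potential. -/
def periodicTraction (μ : ℝ) (e₁ e₂ : Plane) (Γ : Set Plane) (σ : Plane → Plane)
    (v : Plane → Plane) (q : Plane → ℝ) (x n : Plane) : Plane :=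
  nearTraction e₁ e₂ Γ σ x n + traction μ v q x n

/-! ### The particle and the deformed contour -/

/-- A smooth simple closed curve. -/
def IsSmoothClosedCurve (Γ : Set Plane) : Prop :=
  ∃ γ : ℝ → Plane, ContDiff ℝ ∞ γ ∧ Function.Periodic γ 1 ∧ (∀ s, deriv γ s ≠ 0) ∧
    InjOn γ (Ico 0 1) ∧ range γ = Γ

/-- A particle: a bounded domain, bounded by one smooth closed curve, contained with its boundary
in the expanded cell and disjoint from its lattice images. -/
structure IsParticle (e₁ e₂ : Plane) (Ω : Set Plane) : Prop where
  isOpen : IsOpen Ω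
  connected : IsConnected Ω
  bounded : Bornology.IsBounded Ω
  boundary : IsSmoothClosedCurve (frontier Ω)
  subset : closure Ω ⊆ expandedCell e₁ e₂
  disjoint_images : ∀ m k : ℤ, (m, k) ≠ (0, 0) → ∀ x ∈ closure Ω,
    x + latticeVec e₁ e₂ m k ∉ closure Ω

/-- The union of all the translates of the curve `c` by integer multiples of `e₁`. -/
def periodicCurve (e₁ : Plane) (c : ℝ → Plane) : Set Plane :=
  {x | ∃ m : ℤ, ∃ t ∈ Icc (0 : ℝ) 1, x = c t + (m : ℝ) • e₁}

/-- `x` can be joined, without meeting the periodic curve generated by `c`, to a point that is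
higher (in the direction of `e₂`) than every point of that curve. -/
def LiesAbove (e₁ e₂ : Plane) (c : ℝ → Plane) (x : Plane) : Prop :=
  ∃ z, JoinedIn (periodicCurve e₁ c)ᶜ x z ∧
    ∀ w ∈ periodicCurve e₁ c, coordB e₁ e₂ w < coordB e₁ e₂ z

/-- `x` can be joined, without meeting the periodic curve generated by `c`, to a point that is
lower (in the direction of `e₂`) than every point of that curve. -/
def LiesBelow (e₁ e₂ : Plane) (c : ℝ → Plane) (x : Plane) : Prop :=
  ∃ z, JoinedIn (periodicCurve e₁ c)ᶜ x z ∧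
    ∀ w ∈ periodicCurve e₁ c, coordB e₁ e₂ z < coordB e₁ e₂ w

/-- `c` is a deformation of the bottom wall, with the same endpoints, that touches no lattice image
of the particle `Ω` and passes below `Ω`: the row of particles of `Ω` and the rows over it lie
above `c`, the rows under it lie below `c`. -/
structure IsDeformedBottomWall (e₁ e₂ : Plane) (Ω : Set Plane) (c : ℝ → Plane) : Prop where
  piecewiseC1 : IsPiecewiseC1 c
  start : c 0 = wallD e₁ e₂ 0
  finish : c 1 = wallD e₁ e₂ 1
  above : ∀ k : ℤ, 0 ≤ k → ∀ x ∈ closure Ω, LiesAbove e₁ e₂ c (x + latticeVec e₁ e₂ 0 k)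
  below : ∀ k : ℤ, k < 0 → ∀ x ∈ closure Ω, LiesBelow e₁ e₂ c (x + latticeVec e₁ e₂ 0 k)

/-! ### The shifted pieces of the boundary -/

/-- The four quadrants of the skew coordinates, numbered `0, 1, 2, 3` counterclockwise. -/
def quadrant (e₁ e₂ : Plane) : Fin 4 → Set Plane :=
  ![{x | 0 ≤ coordA e₁ e₂ x ∧ 0 ≤ coordB e₁ e₂ x},
    {x | coordA e₁ e₂ x < 0 ∧ 0 ≤ coordB e₁ e₂ x},
    {x | coordA e₁ e₂ x < 0 ∧ coordB e₁ e₂ x < 0},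
    {x | 0 ≤ coordA e₁ e₂ x ∧ coordB e₁ e₂ x < 0}]

/-- The piece of `Γ` in the quadrant `i`. -/
def piece (e₁ e₂ : Plane) (Γ : Set Plane) (i : Fin 4) : Set Plane := Γ ∩ quadrant e₁ e₂ i

/-- The vectors subtracted from the four pieces. -/
def pieceShift (e₁ e₂ : Plane) : Fin 4 → Plane := ![e₁ + e₂, e₂, 0, e₁]

/-- The union of the four shifted pieces. -/
def shiftedBoundary (e₁ e₂ : Plane) (Γ : Set Plane) : Set Plane :=
  ⋃ i, (fun y => y - pieceShift e₁ e₂ i) '' piece e₁ e₂ Γ i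

/-- `σ'` on the shifted boundary is the density `σ` carried along with the pieces. -/
def IsShiftedDensity (e₁ e₂ : Plane) (Γ : Set Plane) (σ σ' : Plane → Plane) : Prop :=
  ∀ i, ∀ y ∈ piece e₁ e₂ Γ i, σ' (y - pieceShift e₁ e₂ i) = σ y

end StokesCell

end

open StokesCell

/-!
On a straight segment the traction of a point force `f` at `z` has an explicit primitive: a
single-valued part plus `f` times the polar angle about `z` divided by `2π`. Hence the line integral
of the traction along a curve depends only on its end points, up to `f` times the number of signed
crossings of a ray issuing from `z`.

The lattice images of a source in the expanded cell are the four images of its representative in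
the lower left quarter by the vectors `0`, `e₁`, `e₂`, `e₁ + e₂`. In each of the two rows the images
one period apart combine into a function of the end points of the deformed wall and the crossings of
that wall and its translate by `-e₁`; these add up to the crossings of the periodic curve, which are
decided by the side on which the source lies. Choosing the ray that avoids the curve, a row above
contributes the value along the straight walls and a row below that value minus `f`. The latter
happens for the row through the lower left quarter exactly when the source has `b ≥ 0`, i.e. lies on
`Γ₁ ∪ Γ₂`. The end point terms of the four images are those of the four shifted walls.

The stress of the correction pair is divergence free, so its traction integral is the same along
the deformed wall and along `D`.
-/

noncomputable section

namespace StokesCell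

open Filter Topology

/-! ### Line integrals -/

theorem deriv_equiv_comp {E G : Type*} [NormedAddCommGroup E] [NormedSpace ℝ E]
    [NormedAddCommGroup G] [NormedSpace ℝ G] (A : E ≃L[ℝ] G) (c : ℝ → E) (t : ℝ) :
    deriv (fun t => A (c t)) t = A (deriv c t) := by
  by_cases ht : DifferentiableAt ℝ c t
  · exact (A.hasFDerivAt.comp_hasDerivAt t ht.hasDerivAt).deriv
  · rw [deriv_zero_of_not_differentiableAt ht, map_zero]
    exact deriv_zero_of_not_differentiableAt fun h => ht (A.comp_differentiableAt_iff.1 h)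

/-- A curve along which the fundamental theorem of calculus holds: continuous on `[0, 1]`,
differentiable off a countable set of parameters, of finite length. -/
structure IsRectifiableCurve {E : Type*} [NormedAddCommGroup E] [NormedSpace ℝ E]
    (c : ℝ → E) : Prop where
  continuousOn : ContinuousOn c (Icc 0 1)
  differentiableAt : ∃ P : Set ℝ, P.Countable ∧ ∀ t ∈ Ioo (0 : ℝ) 1 \ P, DifferentiableAt ℝ c t
  intervalIntegrable_deriv : IntervalIntegrable (deriv c) volume 0 1

namespace IsRectifiableCurve

variable {E G : Type*} [NormedAddCommGroup E] [NormedSpace ℝ E] [NormedAddCommGroup G]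
  [NormedSpace ℝ G] {c : ℝ → E}

theorem of_isPiecewiseC1 {c : ℝ → Plane} (hc : IsPiecewiseC1 c) : IsRectifiableCurve c := by
  obtain ⟨hcont, ⟨P, hP, hd⟩, hint⟩ := hc
  exact ⟨hcont, ⟨P, hP.countable, fun t ht => (hd t ht).differentiableAt one_ne_zero⟩, hint⟩

theorem segment (a d : E) : IsRectifiableCurve fun t : ℝ => a + t • d where
  continuousOn := by fun_prop
  differentiableAt := ⟨∅, countable_empty, fun t _ => by fun_prop⟩
  intervalIntegrable_deriv := by
    have hderiv : deriv (fun t : ℝ => a + t • d) = fun _ => d := by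
      ext1 t
      exact (((hasDerivAt_id' t).smul_const d).const_add a).deriv.trans (one_smul ℝ d)
    rw [hderiv]
    exact intervalIntegrable_const

theorem sub_const (hc : IsRectifiableCurve c) (a : E) : IsRectifiableCurve fun t => c t - a where
  continuousOn := hc.continuousOn.sub continuousOn_const
  differentiableAt := by
    obtain ⟨P, hP, hd⟩ := hc.differentiableAt
    exact ⟨P, hP, fun t ht => (hd t ht).sub_const a⟩
  intervalIntegrable_deriv := by
    rw [show deriv (fun t => c t - a) = deriv c from funext fun _ => deriv_sub_const a]
    exact hc.intervalIntegrable_deriv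

theorem equiv_comp (hc : IsRectifiableCurve c) (A : E ≃L[ℝ] G) :
    IsRectifiableCurve fun t => A (c t) where
  continuousOn := A.continuous.comp_continuousOn hc.continuousOn
  differentiableAt := by
    obtain ⟨P, hP, hd⟩ := hc.differentiableAt
    exact ⟨P, hP, fun t ht => A.differentiableAt.comp t (hd t ht)⟩
  intervalIntegrable_deriv := by
    rw [funext (deriv_equiv_comp A c)]
    exact ⟨A.toContinuousLinearMap.integrable_comp hc.intervalIntegrable_deriv.1,
      A.toContinuousLinearMap.integrable_comp hc.intervalIntegrable_deriv.2⟩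

theorem intervalIntegrable_clm_apply (hc : IsRectifiableCurve c) {A : ℝ → E →L[ℝ] G}
    (hA : ContinuousOn A (Icc 0 1)) :
    IntervalIntegrable (fun t => A t (deriv c t)) volume 0 1 := by
  have hderiv := hc.intervalIntegrable_deriv
  rw [intervalIntegrable_iff_integrableOn_Icc_of_le zero_le_one] at hderiv ⊢
  obtain ⟨C, hC⟩ := isCompact_Icc.exists_bound_of_continuousOn hA
  exact (ContinuousLinearMap.id ℝ (E →L[ℝ] G)).integrable_of_bilin_of_bdd_left C
    (hA.aestronglyMeasurable measurableSet_Icc)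
    ((ae_restrict_mem measurableSet_Icc).mono hC) hderiv

theorem integral_eq_sub_of_hasFDerivAt [CompleteSpace G] (hc : IsRectifiableCurve c) {F : E → G}
    {F' : E → E →L[ℝ] G} (hF : ∀ t ∈ Icc (0 : ℝ) 1, HasFDerivAt F (F' (c t)) (c t))
    (hF' : ContinuousOn (fun t => F' (c t)) (Icc 0 1)) :
    ∫ t in (0 : ℝ)..1, F' (c t) (deriv c t) = F (c 1) - F (c 0) := by
  obtain ⟨P, hP, hd⟩ := hc.differentiableAt
  refine integral_eq_of_hasDerivAt_off_countable_of_le (fun t => F (c t)) _ zero_le_one hP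
    (fun t ht => (hF t ht).continuousAt.comp_continuousWithinAt (hc.continuousOn t ht))
    (fun t ht => ?_) (hc.intervalIntegrable_clm_apply hF')
  exact (hF t (Ioo_subset_Icc_self ht.1)).comp_hasDerivAt t (hd t ht).hasDerivAt

theorem integral_eq_sub_of_hasDerivAt {c : ℝ → ℂ} (hc : IsRectifiableCurve c) {F F' : ℂ → ℂ}
    (hF : ∀ t ∈ Icc (0 : ℝ) 1, HasDerivAt F (F' (c t)) (c t))
    (hF' : ContinuousOn (fun t => F' (c t)) (Icc 0 1)) :
    ∫ t in (0 : ℝ)..1, F' (c t) * deriv c t = F (c 1) - F (c 0) :=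
  hc.integral_eq_sub_of_hasFDerivAt (F' := fun z => F' z • (1 : ℂ →L[ℝ] ℂ))
    (fun t ht => (hF t ht).complexToReal_fderiv) (hF'.smul continuousOn_const)

end IsRectifiableCurve

/-! ### Crossings of a ray -/

/-- `∫_c dx / (x - z)`. -/
def logIntegral (c : ℝ → ℂ) (z : ℂ) : ℂ := ∫ t in (0 : ℝ)..1, (c t - z)⁻¹ * deriv c t

/-- The branch of the logarithm, up to a constant, that is cut along the ray from `0` in the
direction `d`. -/
def rayLog (d u : ℂ) : ℂ := Complex.log (-u / d)

/-- `2πi` times the signed number of times the curve `c` crosses the ray from `z` in the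
direction `d`, if the end points of `c` are not on this ray. -/
def rayCrossing (c : ℝ → ℂ) (d z : ℂ) : ℂ :=
  logIntegral c z - (rayLog d (c 1 - z) - rayLog d (c 0 - z))

theorem neg_div_mem_slitPlane {d u : ℂ} {A B : ℂ →L[ℝ] ℝ} (hA : A d = 0)
    (hB : B d = 1) (h : A u ≠ 0 ∨ B u < 0) : -u / d ∈ Complex.slitPlane := by
  have hd : d ≠ 0 := by
    rintro rfl
    simp at hB
  by_contra hs
  rw [Complex.mem_slitPlane_iff_not_le_zero, not_not, Complex.le_def] at hs
  have hu : u = (-(-u / d).re) • d := by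
    have hreal : -u / d = ((-u / d).re : ℂ) := Complex.ext rfl hs.2
    rw [Complex.real_smul, Complex.ofReal_neg, ← hreal]
    field_simp
  rcases h with h | h
  · exact h (by rw [hu, map_smul, hA, smul_zero])
  · rw [hu, map_smul, hB, smul_eq_mul, mul_one] at h
    exact absurd hs.1 (by simpa using h)

theorem ne_zero_of_neg_div_mem_slitPlane {d u : ℂ} (h : -u / d ∈ Complex.slitPlane) : u ≠ 0 := by
  rintro rfl
  simp at h

theorem hasDerivAt_rayLog {d u : ℂ} (h : -u / d ∈ Complex.slitPlane) :
    HasDerivAt (rayLog d) u⁻¹ u := by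
  have hd : d ≠ 0 := by
    rintro rfl
    simp at h
  have hu := ne_zero_of_neg_div_mem_slitPlane h
  refine (((hasDerivAt_id u).neg.div_const d).clog h).congr_deriv ?_
  simp only [Pi.neg_apply, id_eq]
  field_simp

section

variable {c : ℝ → ℂ} {d z : ℂ}

theorem rayCrossing_eq_zero (hc : IsRectifiableCurve c)
    (h : ∀ t ∈ Icc (0 : ℝ) 1, -(c t - z) / d ∈ Complex.slitPlane) : rayCrossing c d z = 0 := by
  rw [rayCrossing, sub_eq_zero]
  exact hc.integral_eq_sub_of_hasDerivAt (F := fun x => rayLog d (x - z))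
    (F' := fun x => (x - z)⁻¹)
    (fun t ht => HasDerivAt.comp_sub_const _ _ (hasDerivAt_rayLog (h t ht)))
    ((hc.continuousOn.sub continuousOn_const).inv₀ fun t ht =>
      ne_zero_of_neg_div_mem_slitPlane (h t ht))

theorem intervalIntegrable_inv_mul_deriv (hc : IsRectifiableCurve c)
    (hz : ∀ t ∈ Icc (0 : ℝ) 1, c t - z ≠ 0) :
    IntervalIntegrable (fun t => (c t - z)⁻¹ * deriv c t) volume 0 1 :=
  hc.intervalIntegrable_deriv.continuousOn_mul <| by
    rw [uIcc_of_le zero_le_one]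
    exact (hc.continuousOn.sub continuousOn_const).inv₀ hz

theorem logIntegral_add_sub_logIntegral (hc : IsRectifiableCurve c) {h : ℂ}
    (hz : ∀ t ∈ Icc (0 : ℝ) 1, ‖h‖ < ‖c t - z‖) :
    logIntegral c (z + h) - logIntegral c z =
      Complex.log (1 - h / (c 1 - z)) - Complex.log (1 - h / (c 0 - z)) := by
  have hne : ∀ t ∈ Icc (0 : ℝ) 1, c t - z ≠ 0 := fun t ht =>
    norm_pos_iff.1 ((norm_nonneg h).trans_lt (hz t ht))
  have hne_add : ∀ t ∈ Icc (0 : ℝ) 1, c t - (z + h) ≠ 0 := fun t ht h0 => by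
    rw [← sub_sub, sub_eq_zero] at h0
    exact (hz t ht).ne (congrArg norm h0.symm)
  rw [logIntegral, logIntegral, ← intervalIntegral.integral_sub
    (intervalIntegrable_inv_mul_deriv hc hne_add) (intervalIntegrable_inv_mul_deriv hc hne)]
  simp only [← sub_mul]
  refine hc.integral_eq_sub_of_hasDerivAt (F := fun x => Complex.log (1 - h / (x - z)))
    (F' := fun x => (x - (z + h))⁻¹ - (x - z)⁻¹) (fun t ht => ?_)
    (((hc.continuousOn.sub continuousOn_const).inv₀ hne_add).sub
      ((hc.continuousOn.sub continuousOn_const).inv₀ hne))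
  have hslit : 1 - h / (c t - z) ∈ Complex.slitPlane := by
    rw [sub_eq_add_neg]
    refine Complex.mem_slitPlane_of_norm_lt_one ?_
    rw [norm_neg, norm_div]
    exact (div_lt_one (norm_pos_iff.2 (hne t ht))).2 (hz t ht)
  have hu := hne t ht
  have huh : c t - z - h ≠ 0 := by rw [sub_sub]; exact hne_add t ht
  refine ((((hasDerivAt_const (c t) h).div ((hasDerivAt_id (c t)).sub_const z) hu).const_sub
    1).clog hslit).congr_deriv ?_
  simp only [id_eq, Pi.div_apply, ← sub_sub]
  field_simp
  ring

theorem eventually_logIntegral_add_sub_logIntegral (hc : IsRectifiableCurve c)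
    (hz : ∀ t ∈ Icc (0 : ℝ) 1, c t ≠ z) :
    ∀ᶠ h in 𝓝 0, logIntegral c (z + h) - logIntegral c z =
      Complex.log (1 - h / (c 1 - z)) - Complex.log (1 - h / (c 0 - z)) := by
  have hclosed : IsClosed (c '' Icc 0 1) :=
    (isCompact_Icc.image_of_continuousOn hc.continuousOn).isClosed
  have hzc : z ∈ (c '' Icc 0 1)ᶜ := fun ⟨t, ht, h⟩ => hz t ht h
  obtain ⟨ε, hε, hball⟩ := Metric.isOpen_iff.1 hclosed.isOpen_compl z hzc
  filter_upwards [Metric.ball_mem_nhds 0 hε] with h hh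
  rw [mem_ball_zero_iff] at hh
  exact logIntegral_add_sub_logIntegral hc fun t ht =>
    hh.trans_le <| not_lt.1 fun hlt => hball (mem_ball_iff_norm.2 hlt) ⟨t, ht, rfl⟩

theorem eventually_rayLog_sub_sub_rayLog {u : ℂ} (hu : -u / d ∈ Complex.slitPlane) :
    ∀ᶠ h in 𝓝 0, rayLog d (u - h) - rayLog d u = Complex.log (1 - h / u) := by
  have hu0 := ne_zero_of_neg_div_mem_slitPlane hu
  have hcont : ContinuousAt (fun h => 1 - h / u) 0 := by fun_prop
  have harg : Tendsto (fun h => (1 - h / u).arg + (-u / d).arg) (𝓝 0) (𝓝 (-u / d).arg) := by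
    simpa only [Function.comp_apply, zero_div, sub_zero, Complex.arg_one, zero_add] using
      ((Complex.continuousAt_arg Complex.one_mem_slitPlane).comp_of_eq hcont
        (by simp only [zero_div, sub_zero])).tendsto.add_const (-u / d).arg
  have hmem : (-u / d).arg ∈ Ioo (-Real.pi) Real.pi :=
    ⟨Complex.neg_pi_lt_arg _, (Complex.arg_le_pi _).lt_of_ne (Complex.slitPlane_arg_ne_pi hu)⟩
  filter_upwards [harg (Ioo_mem_nhds hmem.1 hmem.2), hcont.eventually_ne (y := 0) (by simp)]
    with h hh hh0
  have hmul : -(u - h) / d = (1 - h / u) * (-u / d) := by field_simp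
  rw [sub_eq_iff_eq_add, rayLog, rayLog, hmul]
  exact (Complex.log_mul_eq_add_log_iff hh0 (Complex.slitPlane_ne_zero hu)).2
    (Ioo_subset_Ioc_self hh)

end

/-! ### A periodic curve seen from a point on one side of it -/

theorem sum_Ico_int_sub {G : Type*} [AddCommGroup G] (f : ℤ → G) {a b : ℤ} (hab : a ≤ b) :
    ∑ m ∈ Finset.Ico a b, (f (m + 1) - f m) = f b - f a := by
  induction b, hab using Int.leInduction with
  | base => simp
  | succ b hb ih =>
    rw [← Finset.insert_Ico_right_eq_Ico_add_one hb, Finset.sum_insert (by simp), ih]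
    abel

section

variable {c : ℝ → ℂ} {d e : ℂ}

theorem sum_Ico_endpoints_sub {G : Type*} [AddCommGroup G] (hce : c 1 = c 0 + e) (f : ℂ → G)
    {N : ℤ} (hN : 0 ≤ N) (z : ℂ) :
    ∑ m ∈ Finset.Ico (-N) N,
        (f (c 1 - (z - (m : ℝ) • e)) - f (c 0 - (z - (m : ℝ) • e))) =
      f (c 0 - z + (N : ℝ) • e) - f (c 0 - z - (N : ℝ) • e) := by
  have hstart : c 0 - z - (N : ℝ) • e = c 0 - z + ((-N : ℤ) : ℝ) • e := by push_cast; module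
  rw [hstart, ← sum_Ico_int_sub (fun m : ℤ => f (c 0 - z + (m : ℝ) • e)) (by lia)]
  refine Finset.sum_congr rfl fun m _ => ?_
  congr 2
  · rw [hce]
    push_cast
    module
  · module

/-- The total crossing of the ray from `z` by the translates of `c` by the multiples
`-N, …, N - 1` of `e`. Instead of the curve by `m e`, the point is moved by `-m e`. -/
def chainCrossing (c : ℝ → ℂ) (e d : ℂ) (N : ℤ) (z : ℂ) : ℂ :=
  ∑ m ∈ Finset.Ico (-N) N, rayCrossing c d (z - (m : ℝ) • e)

theorem chainCrossing_eq (hce : c 1 = c 0 + e) {N : ℤ} (hN : 0 ≤ N) (z : ℂ) :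
    chainCrossing c e d N z = ∑ m ∈ Finset.Ico (-N) N, logIntegral c (z - (m : ℝ) • e) -
      (rayLog d (c 0 - z + (N : ℝ) • e) - rayLog d (c 0 - z - (N : ℝ) • e)) := by
  rw [← sum_Ico_endpoints_sub hce _ hN, ← Finset.sum_sub_distrib]
  rfl

theorem eventually_chainCrossing_eq (hc : IsRectifiableCurve c) (hce : c 1 = c 0 + e) {z : ℂ}
    {N : ℤ} (hN : 0 ≤ N) (hz : ∀ m : ℤ, ∀ t ∈ Icc (0 : ℝ) 1, c t ≠ z - (m : ℝ) • e)
    (hright : -(c 0 - z + (N : ℝ) • e) / d ∈ Complex.slitPlane)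
    (hleft : -(c 0 - z - (N : ℝ) • e) / d ∈ Complex.slitPlane) :
    ∀ᶠ w in 𝓝 z, chainCrossing c e d N w = chainCrossing c e d N z := by
  have hlog : ∀ᶠ h in 𝓝 (0 : ℂ), ∀ m ∈ Finset.Ico (-N) N,
      logIntegral c (z - (m : ℝ) • e + h) - logIntegral c (z - (m : ℝ) • e) =
        Complex.log (1 - h / (c 1 - (z - (m : ℝ) • e))) -
          Complex.log (1 - h / (c 0 - (z - (m : ℝ) • e))) :=
    (Filter.eventually_all_finset _).2 fun m _ =>
      eventually_logIntegral_add_sub_logIntegral hc (hz m)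
  have hshift : ∀ᶠ h in 𝓝 (0 : ℂ),
      chainCrossing c e d N (z + h) = chainCrossing c e d N z := by
    filter_upwards [hlog, eventually_rayLog_sub_sub_rayLog hright,
      eventually_rayLog_sub_sub_rayLog hleft] with h hlog hright hleft
    have hsum := Finset.sum_congr rfl hlog
    rw [sum_Ico_endpoints_sub hce (fun u => Complex.log (1 - h / u)) hN, ← hright, ← hleft,
      Finset.sum_sub_distrib] at hsum
    rw [chainCrossing_eq hce hN, chainCrossing_eq hce hN]
    simp only [add_sub_right_comm, ← sub_sub, sub_right_comm (c 0 - z) h] at hsum ⊢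
    linear_combination hsum
  have htendsto : Tendsto (fun w => w - z) (𝓝 z) (𝓝 0) :=
    tendsto_sub_nhds_zero_iff.2 tendsto_id
  simpa only [add_sub_cancel] using htendsto.eventually hshift

variable {A B : ℂ →L[ℝ] ℝ}

theorem chainCrossing_eq_zero_of_lt (hc : IsRectifiableCurve c) (hAd : A d = 0)
    (hBd : B d = 1) {z : ℂ} (N : ℤ)
    (hz : ∀ m : ℤ, ∀ t ∈ Icc (0 : ℝ) 1, B (c t + (m : ℝ) • e) < B z) :
    chainCrossing c e d N z = 0 := by
  refine Finset.sum_eq_zero fun m _ => rayCrossing_eq_zero hc fun t ht => ?_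
  refine neg_div_mem_slitPlane hAd hBd (Or.inr ?_)
  rw [← sub_add, sub_add_eq_add_sub, map_sub]
  exact sub_neg_of_lt (hz m t ht)

/-- Only the translates of `c` by `-e` and `0` meet the strip of `z`. -/
theorem chainCrossing_eq_add (hc : IsRectifiableCurve c) (hAe : A e = 1)
    (hAd : A d = 0) (hBd : B d = 1) (hcA : ∀ t ∈ Icc (0 : ℝ) 1, A (c t) ∈ Ico (-1 : ℝ) 1) {z : ℂ}
    (hz : A z ∈ Ico (-1 : ℝ) 0) {N : ℤ} (hN : 1 ≤ N) :
    chainCrossing c e d N z = rayCrossing c d z + rayCrossing c d (z + e) := by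
  have hsub : ({0, -1} : Finset ℤ) ⊆ Finset.Ico (-N) N := by
    intro m hm
    simp only [Finset.mem_insert, Finset.mem_singleton] at hm
    exact Finset.mem_Ico.2 (by lia)
  rw [chainCrossing, ← Finset.sum_subset hsub, Finset.sum_pair (by norm_num)]
  · simp
  intro m _ hm
  simp only [Finset.mem_insert, Finset.mem_singleton, not_or] at hm
  refine rayCrossing_eq_zero hc fun t ht => neg_div_mem_slitPlane hAd hBd (Or.inl ?_)
  have hval : A (c t - (z - (m : ℝ) • e)) = A (c t) - A z + m := by
    simp only [map_sub, map_smul, hAe, smul_eq_mul]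
    ring
  have hct := hcA t ht
  rw [hval]
  rcases (by lia : 1 ≤ m ∨ m ≤ -2) with hm | hm
  · have : (1 : ℝ) ≤ m := by exact_mod_cast hm
    exact (by linarith [hct.1, hz.2] : (0 : ℝ) < _).ne'
  · have : (m : ℝ) ≤ -2 := by exact_mod_cast hm
    exact (by linarith [hct.2, hz.1] : _ < (0 : ℝ)).ne

theorem rayCrossing_add_rayCrossing_eq_zero (hc : IsRectifiableCurve c) (hce : c 1 = c 0 + e)
    (hAe : A e = 1) (hAd : A d = 0) (hBd : B d = 1)
    (hcA : ∀ t ∈ Icc (0 : ℝ) 1, A (c t) ∈ Ico (-1 : ℝ) 1) {z w : ℂ} (hz : A z ∈ Ico (-1 : ℝ) 0)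
    (hzw : JoinedIn {x | ∀ m : ℤ, ∀ t ∈ Icc (0 : ℝ) 1, c t + (m : ℝ) • e ≠ x} z w)
    (hw : ∀ m : ℤ, ∀ t ∈ Icc (0 : ℝ) 1, B (c t + (m : ℝ) • e) < B w) :
    rayCrossing c d z + rayCrossing c d (z + e) = 0 := by
  obtain ⟨γ, hγ⟩ := hzw
  obtain ⟨C, hC⟩ := isCompact_univ.exists_bound_of_continuousOn
    (A.continuous.comp γ.continuous).continuousOn
  obtain ⟨N, hN⟩ := exists_int_gt (C + 1)
  have hstrip : ∀ s, |A (γ s)| + 1 < N := fun s =>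
    (add_le_add_left (hC s (mem_univ s)) 1).trans_lt hN
  have hN1 : 1 ≤ N := by
    have : (0 : ℝ) < N := (by positivity : (0 : ℝ) < |A (γ 0)| + 1).trans (hstrip 0)
    exact_mod_cast this
  have hc0 := hcA 0 ⟨le_rfl, zero_le_one⟩
  have hloc : IsLocallyConstant fun s => chainCrossing c e d N (γ s) := by
    refine (IsLocallyConstant.iff_eventually_eq _).2 fun s => γ.continuous.continuousAt.eventually
      (eventually_chainCrossing_eq hc hce (by lia)
        (fun m t ht h => hγ s m t ht (by rw [h, sub_add_cancel])) ?_ ?_) <;>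
    · obtain ⟨hlo, hhi⟩ := abs_lt.1 (lt_sub_iff_add_lt.2 (hstrip s))
      refine neg_div_mem_slitPlane hAd hBd (Or.inl ?_)
      simp only [map_sub, map_add, map_smul, hAe, smul_eq_mul, mul_one]
      intro h
      linarith [hc0.1, hc0.2]
  have hends := hloc.apply_eq_of_preconnectedSpace 0 1
  simp only [γ.source, γ.target] at hends
  rwa [chainCrossing_eq_zero_of_lt hc hAd hBd N hw,
    chainCrossing_eq_add hc hAe hAd hBd hcA hz hN1] at hends

end

/-! ### The plane as the complex line -/

/-- The isometry `x ↦ x₁ + i x₂`. -/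
def toC : Plane ≃ₗᵢ[ℝ] ℂ := Complex.orthonormalBasisOneI.repr.symm

theorem toC_re (x : Plane) : (toC x).re = x 0 := by
  simp [toC, ← OrthonormalBasis.sum_repr_symm]

theorem toC_im (x : Plane) : (toC x).im = x 1 := by
  simp [toC, ← OrthonormalBasis.sum_repr_symm]

theorem toC_perp (x : Plane) : toC (perp x) = Complex.I * toC x := by
  apply Complex.ext <;> simp [toC_re, toC_im, perp]

theorem inner_eq_re_conj_toC_mul (x y : Plane) :
    ⟪x, y⟫_ℝ = ((starRingEnd ℂ) (toC x) * toC y).re := by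
  rw [← toC.inner_map_map, Complex.inner, mul_comm]

theorem im_toC_div (x y : Plane) : (toC x / toC y).im = -cross x y / ‖y‖ ^ 2 := by
  rw [← toC.norm_map y, ← Complex.normSq_eq_norm_sq, Complex.div_im]
  simp only [toC_re, toC_im, cross]
  ring

theorem inner_perp_div_norm_sq (r h : Plane) :
    ⟪r, perp h⟫_ℝ / ‖r‖ ^ 2 = -((toC r)⁻¹ * toC h).im := by
  rw [inner_eq_re_conj_toC_mul, toC_perp, ← toC.norm_map r, ← Complex.normSq_eq_norm_sq,
    Complex.inv_def, mul_right_comm, Complex.im_mul_ofReal, mul_left_comm, Complex.I_mul_re,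
    div_eq_mul_inv, neg_mul]

/-- The orthogonal projection of `f` onto the line of `r` is the mean of `f` and its mirror
image. -/
theorem toC_inner_div_norm_sq_smul {r : Plane} (hr : r ≠ 0) (f : Plane) :
    toC ((⟪r, f⟫_ℝ / ‖r‖ ^ 2) • r) =
      (1 / 2 : ℝ) • (toC f + toC r / (starRingEnd ℂ) (toC r) * (starRingEnd ℂ) (toC f)) := by
  have hr0 : toC r ≠ 0 := by simpa using hr
  have hconj : (starRingEnd ℂ) (toC r) ≠ 0 := by simpa using hr
  rw [inner_eq_re_conj_toC_mul, ← toC.norm_map r, map_smul, Complex.real_smul, Complex.real_smul]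
  push_cast
  rw [Complex.re_eq_add_conj, ← Complex.conj_mul']
  simp only [map_mul, Complex.conj_conj]
  field_simp

/-! ### The primitive of the traction kernel -/

/-- The differential form `dθ / 2π` at the point `r`, for the polar angle `θ` of `r`. -/
def angleForm (r : ℂ) : ℂ →L[ℝ] ℝ :=
  (2 * Real.pi)⁻¹ • Complex.imCLM ∘L ContinuousLinearMap.mul ℝ ℂ r⁻¹

theorem angleForm_apply (r h : ℂ) : angleForm r h = (2 * Real.pi)⁻¹ * (r⁻¹ * h).im := rfl

theorem continuousOn_angleForm : ContinuousOn angleForm {0}ᶜ := by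
  have hmul : ContinuousOn (fun r : ℂ => ContinuousLinearMap.mul ℝ ℂ r⁻¹) {0}ᶜ :=
    (ContinuousLinearMap.mul ℝ ℂ).continuous.comp_continuousOn continuousOn_inv₀
  have hcomp : ContinuousOn
      (fun r : ℂ => Complex.imCLM ∘L ContinuousLinearMap.mul ℝ ℂ r⁻¹) {0}ᶜ :=
    continuousOn_const.clm_comp hmul
  exact hcomp.const_smul (2 * Real.pi)⁻¹

theorem continuousOn_angleForm_smulRight_div_conj :
    ContinuousOn (fun r => (angleForm r).smulRight (r / (starRingEnd ℂ) r)) {0}ᶜ := by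
  have hquot : ContinuousOn (fun r : ℂ => r / (starRingEnd ℂ) r) {0}ᶜ :=
    continuousOn_id.div Complex.continuous_conj.continuousOn fun r hr => (map_ne_zero _).2 hr
  exact ((ContinuousLinearMap.smulRightL ℝ ℂ ℂ).continuous.comp_continuousOn
    continuousOn_angleForm).clm_apply hquot

theorem toC_tractionKernel {x z : Plane} (hxz : x ≠ z) (h f : Plane) :
    toC (tractionKernel x (perp h) z f) =
      angleForm (toC x - toC z) (toC h) •
        (toC f + (toC x - toC z) / (starRingEnd ℂ) (toC x - toC z) * (starRingEnd ℂ) (toC f)) := by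
  rw [tractionKernel, inner_perp_div_norm_sq, mul_right_comm, mul_smul, map_smul,
    toC_inner_div_norm_sq_smul (sub_ne_zero.2 hxz), smul_smul, angleForm_apply, map_sub]
  congr 1
  field_simp

theorem ofReal_angleForm (r h : ℂ) :
    ((angleForm r h : ℝ) : ℂ) =
      (h / r - (starRingEnd ℂ) h / (starRingEnd ℂ) r) / (4 * Real.pi * Complex.I) := by
  rw [angleForm_apply, Complex.ofReal_mul, Complex.im_eq_sub_conj]
  simp only [map_mul, map_inv₀]
  push_cast
  field_simp
  ring

/-- The single-valued part of the primitive of the traction kernel. -/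
def kernelPrimitive (r : ℂ) : ℂ := r / (4 * Real.pi * Complex.I * (starRingEnd ℂ) r)

theorem hasFDerivAt_kernelPrimitive {r : ℂ} (hr : r ≠ 0) :
    HasFDerivAt kernelPrimitive ((angleForm r).smulRight (r / (starRingEnd ℂ) r)) r := by
  have hconj : (starRingEnd ℂ) r ≠ 0 := by simpa using hr
  have hk : (4 * Real.pi * Complex.I : ℂ) ≠ 0 := by simp [Real.pi_ne_zero]
  have hden : HasFDerivAt (fun r : ℂ => 4 * Real.pi * Complex.I * (starRingEnd ℂ) r)
      ((4 * Real.pi * Complex.I : ℂ) • Complex.conjCLE.toContinuousLinearMap) r :=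
    Complex.conjCLE.toContinuousLinearMap.hasFDerivAt.const_mul (4 * Real.pi * Complex.I : ℂ)
  refine ((hasFDerivAt_id r).mul
    ((hasFDerivAt_inv' (mul_ne_zero hk hconj)).comp r hden)).congr_fderiv ?_
  ext1 h
  rw [ContinuousLinearMap.smulRight_apply, Complex.real_smul, ofReal_angleForm]
  generalize (4 * Real.pi * Complex.I : ℂ) = k at hk
  simp only [id_eq, ContinuousLinearMap.neg_comp, smul_neg, Function.comp_apply, add_apply,
    neg_apply, smul_apply, ContinuousLinearMap.comp_apply, ContinuousLinearEquiv.coe_coe,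
    ContinuousAlgEquiv.coeCLE_apply, Complex.conjCAE_apply, smul_eq_mul,
    ContinuousLinearMap.mulLeftRight_apply, ContinuousLinearMap.id_apply]
  field_simp
  ring

section

variable {c : ℝ → ℂ} {z : ℂ}

theorem integral_angleForm_eq_im_logIntegral (hc : IsRectifiableCurve c)
    (hz : ∀ t ∈ Icc (0 : ℝ) 1, c t - z ≠ 0) :
    ∫ t in (0 : ℝ)..1, angleForm (c t - z) (deriv c t) =
      (2 * Real.pi)⁻¹ * (logIntegral c z).im := by
  simp only [angleForm_apply]
  rw [intervalIntegral.integral_const_mul]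
  congr 1
  exact Complex.imCLM.intervalIntegral_comp_comm (intervalIntegrable_inv_mul_deriv hc hz)

theorem integral_angleForm_smul_div_conj (hc : IsRectifiableCurve c)
    (hz : ∀ t ∈ Icc (0 : ℝ) 1, c t - z ≠ 0) :
    ∫ t in (0 : ℝ)..1,
        angleForm (c t - z) (deriv c t) • ((c t - z) / (starRingEnd ℂ) (c t - z)) =
      kernelPrimitive (c 1 - z) - kernelPrimitive (c 0 - z) :=
  hc.integral_eq_sub_of_hasFDerivAt (F := fun x => kernelPrimitive (x - z))
    (F' := fun x => (angleForm (x - z)).smulRight ((x - z) / (starRingEnd ℂ) (x - z)))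
    (fun t ht => (hasFDerivAt_comp_sub z).2 (hasFDerivAt_kernelPrimitive (hz t ht)))
    (continuousOn_angleForm_smulRight_div_conj.comp
      (hc.continuousOn.sub continuousOn_const) hz)

theorem integral_angleForm_smul_add (hc : IsRectifiableCurve c)
    (hz : ∀ t ∈ Icc (0 : ℝ) 1, c t - z ≠ 0) (f g : ℂ) :
    ∫ t in (0 : ℝ)..1,
        angleForm (c t - z) (deriv c t) • (f + (c t - z) / (starRingEnd ℂ) (c t - z) * g) =
      ((2 * Real.pi)⁻¹ * (logIntegral c z).im) • f +
        (kernelPrimitive (c 1 - z) - kernelPrimitive (c 0 - z)) * g := by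
  have hsub : ContinuousOn (fun t => c t - z) (Icc 0 1) := hc.continuousOn.sub continuousOn_const
  have hangle : IntervalIntegrable (fun t => angleForm (c t - z) (deriv c t)) volume 0 1 :=
    hc.intervalIntegrable_clm_apply (continuousOn_angleForm.comp hsub hz)
  have hmirror : IntervalIntegrable (fun t => angleForm (c t - z) (deriv c t) •
      ((c t - z) / (starRingEnd ℂ) (c t - z))) volume 0 1 :=
    hc.intervalIntegrable_clm_apply (continuousOn_angleForm_smulRight_div_conj.comp hsub hz)
  simp only [smul_add, ← smul_mul_assoc]
  rw [intervalIntegral.integral_add ⟨hangle.1.smul_const f, hangle.2.smul_const f⟩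
    (hmirror.mul_const g), intervalIntegral.integral_smul_const,
    intervalIntegral.integral_mul_const, integral_angleForm_eq_im_logIntegral hc hz,
    integral_angleForm_smul_div_conj hc hz]

end

/-- `∫_c Gᵗ(·, z) f ds`, the traction of a point force `f` at `z` on the curve `c`. -/
def kernelIntegral (c : ℝ → Plane) (z f : Plane) : Plane :=
  ∫ t in (0 : ℝ)..1, tractionKernel (c t) (perp (deriv c t)) z f

theorem deriv_toC (c : ℝ → Plane) (t : ℝ) : deriv (fun t => toC (c t)) t = toC (deriv c t) :=
  deriv_equiv_comp toC.toContinuousLinearEquiv c t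

theorem IsRectifiableCurve.toC_comp {c : ℝ → Plane} (hc : IsRectifiableCurve c) :
    IsRectifiableCurve fun t => toC (c t) :=
  hc.equiv_comp toC.toContinuousLinearEquiv

theorem toC_kernelIntegral {c : ℝ → Plane} (hc : IsRectifiableCurve c) {z : Plane}
    (hz : ∀ t ∈ Icc (0 : ℝ) 1, c t ≠ z) (f : Plane) :
    toC (kernelIntegral c z f) =
      ((2 * Real.pi)⁻¹ * (logIntegral (fun t => toC (c t)) (toC z)).im) • toC f +
      (kernelPrimitive (toC (c 1) - toC z) - kernelPrimitive (toC (c 0) - toC z)) *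
        (starRingEnd ℂ) (toC f) := by
  have hne : ∀ t ∈ Icc (0 : ℝ) 1, toC (c t) - toC z ≠ 0 := fun t ht =>
    sub_ne_zero.2 (toC.injective.ne (hz t ht))
  rw [← integral_angleForm_smul_add hc.toC_comp hne, kernelIntegral,
    intervalIntegral.integral_of_le zero_le_one, intervalIntegral.integral_of_le zero_le_one]
  refine (toC.toContinuousLinearEquiv.integral_comp_comm _).symm.trans
    (setIntegral_congr_fun measurableSet_Ioc fun t ht => ?_)
  simp only [deriv_toC]
  exact toC_tractionKernel (hz t (Ioc_subset_Icc_self ht)) (deriv c t) f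

/-- A primitive, off the ray from `0` in the direction `d`, of the traction of a point force `f`
at `0`. The argument of the logarithm is that of the branch cut along this ray. -/
def sourcePotential (d f u : Plane) : Plane :=
  ((2 * Real.pi)⁻¹ * (rayLog (toC d) (toC u)).im) • f +
    toC.symm (kernelPrimitive (toC u) * (starRingEnd ℂ) (toC f))

theorem kernelIntegral_eq {c : ℝ → Plane} (hc : IsRectifiableCurve c) {z : Plane}
    (hz : ∀ t ∈ Icc (0 : ℝ) 1, c t ≠ z) (d f : Plane) :
    kernelIntegral c z f =
      sourcePotential d f (c 1 - z) - sourcePotential d f (c 0 - z) +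
        ((2 * Real.pi)⁻¹ * (rayCrossing (fun t => toC (c t)) (toC d) (toC z)).im) • f := by
  apply toC.injective
  rw [toC_kernelIntegral hc hz]
  simp only [sourcePotential, rayCrossing, map_add, map_sub, map_smul, toC.apply_symm_apply,
    Complex.sub_im, Complex.real_smul]
  push_cast
  ring

section

variable {c : ℝ → Plane} {d e z : Plane} {A B : Plane →L[ℝ] ℝ}

theorem kernelIntegral_eq_sourcePotential_sub (hc : IsRectifiableCurve c) (hAd : A d = 0)
    (hBd : B d = 1) (h : ∀ t ∈ Icc (0 : ℝ) 1, A (c t - z) ≠ 0 ∨ B (c t - z) < 0) (f : Plane) :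
    kernelIntegral c z f = sourcePotential d f (c 1 - z) - sourcePotential d f (c 0 - z) := by
  have hz : ∀ t ∈ Icc (0 : ℝ) 1, c t ≠ z := by
    rintro t ht rfl
    simpa using h t ht
  have hcross : rayCrossing (fun t => toC (c t)) (toC d) (toC z) = 0 := by
    refine rayCrossing_eq_zero hc.toC_comp fun t ht => ?_
    refine neg_div_mem_slitPlane
      (A := A ∘L toC.symm.toContinuousLinearEquiv.toContinuousLinearMap)
      (B := B ∘L toC.symm.toContinuousLinearEquiv.toContinuousLinearMap) ?_ ?_ ?_
    · simpa using hAd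
    · simpa using hBd
    · simpa using h t ht
  rw [kernelIntegral_eq hc hz d f, hcross]
  simp

theorem joinedIn_toC {w : Plane} (h : JoinedIn (periodicCurve e c)ᶜ z w) :
    JoinedIn {x | ∀ m : ℤ, ∀ t ∈ Icc (0 : ℝ) 1, toC (c t) + (m : ℝ) • toC e ≠ x}
      (toC z) (toC w) := by
  refine (h.map_continuousOn toC.continuous.continuousOn).mono ?_
  rintro _ ⟨x, hx, rfl⟩ m t ht heq
  refine hx ⟨m, t, ht, toC.injective ?_⟩
  rw [← heq, map_add, map_smul]

theorem kernelIntegral_add_kernelIntegral (hc : IsRectifiableCurve c) (hce : c 1 = c 0 + e)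
    (hAe : A e = 1) (hAd : A d = 0) (hBd : B d = 1)
    (hcA : ∀ t ∈ Icc (0 : ℝ) 1, A (c t) ∈ Ico (-1 : ℝ) 1) (hz : A z ∈ Ico (-1 : ℝ) 0) {w : Plane}
    (hzw : JoinedIn (periodicCurve e c)ᶜ z w) (hw : ∀ x ∈ periodicCurve e c, B x < B w)
    (f : Plane) :
    kernelIntegral c z f + kernelIntegral c (z + e) f =
      sourcePotential d f (c 0 + e - z) - sourcePotential d f (c 0 - e - z) := by
  have hne : ∀ m : ℤ, ∀ t ∈ Icc (0 : ℝ) 1, c t ≠ z + (m : ℝ) • e := fun m t ht heq =>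
    hzw.source_mem ⟨-m, t, ht, by rw [heq]; push_cast; module⟩
  have hcross : rayCrossing (fun t => toC (c t)) (toC d) (toC z) +
      rayCrossing (fun t => toC (c t)) (toC d) (toC z + toC e) = 0 := by
    refine rayCrossing_add_rayCrossing_eq_zero
      (A := A ∘L toC.symm.toContinuousLinearEquiv.toContinuousLinearMap)
      (B := B ∘L toC.symm.toContinuousLinearEquiv.toContinuousLinearMap)
      hc.toC_comp ?_ ?_ ?_ ?_ ?_ ?_ (joinedIn_toC hzw) ?_
    · rw [hce, map_add]
    · simpa using hAe
    · simpa using hAd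
    · simpa using hBd
    · simpa using hcA
    · simpa using hz
    · intro m t ht
      change B (toC.symm (toC (c t) + (m : ℝ) • toC e)) < B (toC.symm (toC w))
      rw [← map_smul, ← map_add, toC.symm_apply_apply, toC.symm_apply_apply]
      exact hw _ ⟨m, t, ht, rfl⟩
  rw [kernelIntegral_eq hc (by simpa using hne 0) d f,
    kernelIntegral_eq hc (by simpa using hne 1) d f, hce, add_sub_add_right_eq_sub,
    ← sub_sub (c 0), sub_right_comm (c 0), map_add toC z,
    eq_neg_of_add_eq_zero_left hcross, Complex.neg_im]
  module

end

theorem sourcePotential_neg_of_pos {d u : Plane} (h : 0 < cross u d) (f : Plane) :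
    sourcePotential (-d) f u = sourcePotential d f u - (1 / 2 : ℝ) • f := by
  have hd : d ≠ 0 := by
    rintro rfl
    simp [cross] at h
  have him : (toC u / toC d).im < 0 := by
    rw [im_toC_div]
    exact div_neg_of_neg_of_pos (neg_lt_zero.2 h) (by positivity)
  have hlog : (rayLog (toC d) (toC u)).im = (rayLog (toC (-d)) (toC u)).im + Real.pi := by
    rw [rayLog, rayLog, map_neg, neg_div_neg_eq, neg_div, Complex.log_im, Complex.log_im,
      Complex.arg_neg_eq_arg_add_pi_of_im_neg him]
  have hhalf : (2 * Real.pi)⁻¹ * Real.pi = 1 / 2 := by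
    have hpi := Real.pi_ne_zero
    field_simp
  rw [sourcePotential, sourcePotential, hlog, mul_add, hhalf]
  module

theorem sourcePotential_neg_of_neg {d u : Plane} (h : cross u d < 0) (f : Plane) :
    sourcePotential (-d) f u = sourcePotential d f u + (1 / 2 : ℝ) • f := by
  have hneg : 0 < cross u (-d) := by
    have : cross u (-d) = -cross u d := by simp only [cross, PiLp.neg_apply]; ring
    rwa [this, neg_pos]
  have hflip := sourcePotential_neg_of_pos hneg f
  rw [neg_neg] at hflip
  rw [hflip, sub_add_cancel]

/-! ### Skew coordinates and the shifted walls -/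

/-- `coordA` as a continuous linear form. -/
def coordAL (e₁ e₂ : Plane) : Plane →L[ℝ] ℝ :=
  LinearMap.toContinuousLinearMap
    { toFun := coordA e₁ e₂
      map_add' := fun x y => by simp only [coordA, cross, PiLp.add_apply]; ring
      map_smul' := fun a x => by
        simp only [coordA, cross, PiLp.smul_apply, smul_eq_mul, RingHom.id_apply]; ring }

/-- `coordB` as a continuous linear form. -/
def coordBL (e₁ e₂ : Plane) : Plane →L[ℝ] ℝ :=
  LinearMap.toContinuousLinearMap
    { toFun := coordB e₁ e₂
      map_add' := fun x y => by simp only [coordB, cross, PiLp.add_apply]; ring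
      map_smul' := fun a x => by
        simp only [coordB, cross, PiLp.smul_apply, smul_eq_mul, RingHom.id_apply]; ring }

section

variable {e₁ e₂ : Plane}

theorem coordA_add (x y : Plane) : coordA e₁ e₂ (x + y) = coordA e₁ e₂ x + coordA e₁ e₂ y :=
  map_add (coordAL e₁ e₂) x y

theorem coordA_sub (x y : Plane) : coordA e₁ e₂ (x - y) = coordA e₁ e₂ x - coordA e₁ e₂ y :=
  map_sub (coordAL e₁ e₂) x y

theorem coordA_smul (a : ℝ) (x : Plane) : coordA e₁ e₂ (a • x) = a * coordA e₁ e₂ x :=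
  map_smul (coordAL e₁ e₂) a x

theorem coordB_add (x y : Plane) : coordB e₁ e₂ (x + y) = coordB e₁ e₂ x + coordB e₁ e₂ y :=
  map_add (coordBL e₁ e₂) x y

theorem coordB_sub (x y : Plane) : coordB e₁ e₂ (x - y) = coordB e₁ e₂ x - coordB e₁ e₂ y :=
  map_sub (coordBL e₁ e₂) x y

theorem coordB_smul (a : ℝ) (x : Plane) : coordB e₁ e₂ (a • x) = a * coordB e₁ e₂ x :=
  map_smul (coordBL e₁ e₂) a x

theorem coordA_e₁ (he : cross e₁ e₂ ≠ 0) : coordA e₁ e₂ e₁ = 1 := div_self he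

theorem coordA_e₂ : coordA e₁ e₂ e₂ = 0 := by
  rw [coordA, cross, mul_comm, sub_self, zero_div]

theorem coordB_e₁ : coordB e₁ e₂ e₁ = 0 := by
  rw [coordB, cross, mul_comm, sub_self, zero_div]

theorem coordB_e₂ (he : cross e₁ e₂ ≠ 0) : coordB e₁ e₂ e₂ = 1 := div_self he

theorem coordA_corner (he : cross e₁ e₂ ≠ 0) : coordA e₁ e₂ (corner e₁ e₂) = -(1 / 2) := by
  rw [corner, ← neg_smul, coordA_smul, coordA_add, coordA_e₁ he, coordA_e₂]
  ring

theorem coordB_corner (he : cross e₁ e₂ ≠ 0) : coordB e₁ e₂ (corner e₁ e₂) = -(1 / 2) := by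
  rw [corner, ← neg_smul, coordB_smul, coordB_add, coordB_e₁, coordB_e₂ he]
  ring

/-- The lower left quarter of the expanded cell. -/
def lowerLeftCell (e₁ e₂ : Plane) : Set Plane :=
  {x | coordA e₁ e₂ x ∈ Ico (-1 : ℝ) 0 ∧ coordB e₁ e₂ x ∈ Ico (-1 : ℝ) 0}

/-- The walls `R - e₂`, `L - e₁ - e₂`, `D - e₁ - e₂` and `D - e₂`. -/
def shiftedWalls (e₁ e₂ : Plane) : Set (ℝ → Plane) :=
  {shiftCurve (wallR e₁ e₂) e₂, shiftCurve (wallL e₁ e₂) (e₁ + e₂),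
    shiftCurve (wallD e₁ e₂) (e₁ + e₂), shiftCurve (wallD e₁ e₂) e₂}

/-- The combination of the shifted walls that replaces the deformed bottom wall, for a quantity
`I` attached to curves. -/
def shiftedWallSum (e₁ e₂ : Plane) (I : (ℝ → Plane) → Plane) : Plane :=
  I (shiftCurve (wallR e₁ e₂) e₂) - I (shiftCurve (wallL e₁ e₂) (e₁ + e₂))
    + (2 : ℝ) • I (shiftCurve (wallD e₁ e₂) (e₁ + e₂)) + (2 : ℝ) • I (shiftCurve (wallD e₁ e₂) e₂)

theorem shiftedWallSum_congr {I J : (ℝ → Plane) → Plane}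
    (h : ∀ b ∈ shiftedWalls e₁ e₂, I b = J b) :
    shiftedWallSum e₁ e₂ I = shiftedWallSum e₁ e₂ J := by
  simp only [shiftedWalls, mem_insert_iff, mem_singleton_iff, forall_eq_or_imp, forall_eq] at h
  obtain ⟨hR, hL, hD₁, hD₂⟩ := h
  rw [shiftedWallSum, shiftedWallSum, hR, hL, hD₁, hD₂]

theorem shiftedWallSum_sub_endpoints (Φ : Plane → Plane) :
    shiftedWallSum e₁ e₂ (fun b => Φ (b 1) - Φ (b 0)) =
      (Φ (corner e₁ e₂ + e₁) - Φ (corner e₁ e₂ - e₁)) +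
        (Φ (corner e₁ e₂ + e₁ - e₂) - Φ (corner e₁ e₂ - e₁ - e₂)) := by
  have hL : corner e₁ e₂ + e₂ - (e₁ + e₂) = corner e₁ e₂ - e₁ := by abel
  have hD : corner e₁ e₂ + e₁ - (e₁ + e₂) = corner e₁ e₂ - e₂ := by abel
  simp only [shiftedWallSum, shiftCurve, wallR, wallL, wallD, seg, one_smul, zero_smul, add_zero,
    add_sub_cancel_right, hL, hD, ← sub_sub (corner e₁ e₂)]
  module

theorem isRectifiableCurve_of_mem_shiftedWalls {b : ℝ → Plane} (hb : b ∈ shiftedWalls e₁ e₂) :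
    IsRectifiableCurve b := by
  simp only [shiftedWalls, mem_insert_iff, mem_singleton_iff] at hb
  rcases hb with rfl | rfl | rfl | rfl <;> exact (IsRectifiableCurve.segment _ _).sub_const _

theorem coord_sub_of_mem_shiftedWalls (he : cross e₁ e₂ ≠ 0) {b : ℝ → Plane}
    (hb : b ∈ shiftedWalls e₁ e₂) {t : ℝ} {z : Plane} (hz : z ∈ lowerLeftCell e₁ e₂) :
    1 / 2 ≤ coordA e₁ e₂ (b t - z) ∨ coordA e₁ e₂ (b t - z) ≤ -(1 / 2) ∨
      coordB e₁ e₂ (b t - z) ≤ -(1 / 2) := by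
  obtain ⟨⟨hA, hA'⟩, hB, -⟩ := hz
  simp only [shiftedWalls, mem_insert_iff, mem_singleton_iff] at hb
  rcases hb with rfl | rfl | rfl | rfl
  · left
    simp only [shiftCurve, wallR, seg, coordA_add, coordA_sub, coordA_smul, coordA_e₁ he, coordA_e₂,
      coordA_corner he]
    linarith
  · right; left
    simp only [shiftCurve, wallL, seg, coordA_add, coordA_sub, coordA_smul, coordA_e₁ he, coordA_e₂,
      coordA_corner he]
    linarith
  all_goals
    right; right
    simp only [shiftCurve, wallD, seg, coordB_add, coordB_sub, coordB_smul, coordB_e₁, coordB_e₂ he,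
      coordB_corner he]
    linarith

/-! ### The traction of the four images of one source -/

theorem shiftedWallSum_kernelIntegral (he : cross e₁ e₂ ≠ 0) {z : Plane}
    (hz : z ∈ lowerLeftCell e₁ e₂) (f : Plane) :
    shiftedWallSum e₁ e₂ (fun b => kernelIntegral b z f) =
      shiftedWallSum e₁ e₂
        (fun b => sourcePotential e₂ f (b 1 - z) - sourcePotential e₂ f (b 0 - z)) := by
  refine shiftedWallSum_congr fun b hb => kernelIntegral_eq_sourcePotential_sub
    (A := coordAL e₁ e₂) (B := coordBL e₁ e₂) (isRectifiableCurve_of_mem_shiftedWalls hb)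
    coordA_e₂ (coordB_e₂ he) (fun t _ => ?_) f
  rcases coord_sub_of_mem_shiftedWalls he hb (t := t) hz with h | h | h
  · exact Or.inl (lt_of_lt_of_le one_half_pos h).ne'
  · exact Or.inl (lt_of_le_of_lt h (neg_lt_zero.2 one_half_pos)).ne
  · exact Or.inr (lt_of_le_of_lt h (neg_lt_zero.2 one_half_pos))

variable {c : ℝ → Plane} {z : Plane}

theorem LiesAbove.kernelIntegral_add_kernelIntegral (h : LiesAbove e₁ e₂ c z)
    (he : cross e₁ e₂ ≠ 0) (hc : IsRectifiableCurve c) (hce : c 1 = c 0 + e₁)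
    (hcA : ∀ t ∈ Icc (0 : ℝ) 1, coordA e₁ e₂ (c t) ∈ Ico (-1 : ℝ) 1)
    (hz : coordA e₁ e₂ z ∈ Ico (-1 : ℝ) 0) (f : Plane) :
    kernelIntegral c z f + kernelIntegral c (z + e₁) f =
      sourcePotential e₂ f (c 0 + e₁ - z) - sourcePotential e₂ f (c 0 - e₁ - z) := by
  obtain ⟨w, hzw, hw⟩ := h
  exact StokesCell.kernelIntegral_add_kernelIntegral (A := coordAL e₁ e₂) (B := coordBL e₁ e₂)
    hc hce (coordA_e₁ he) coordA_e₂ (coordB_e₂ he) hcA hz hzw hw f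

/-- Below the curve the ray in the direction `-e₂` avoids it. The two branches of the angle agree up
to half turns, in opposite senses at the two end points: this is where `-f` comes from. -/
theorem LiesBelow.kernelIntegral_add_kernelIntegral (h : LiesBelow e₁ e₂ c z)
    (he : 0 < cross e₁ e₂) (hc : IsRectifiableCurve c) (hc0 : c 0 = corner e₁ e₂)
    (hce : c 1 = c 0 + e₁)
    (hcA : ∀ t ∈ Icc (0 : ℝ) 1, coordA e₁ e₂ (c t) ∈ Ico (-1 : ℝ) 1)
    (hz : coordA e₁ e₂ z ∈ Ico (-1 : ℝ) 0) (f : Plane) :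
    kernelIntegral c z f + kernelIntegral c (z + e₁) f =
      sourcePotential e₂ f (c 0 + e₁ - z) - sourcePotential e₂ f (c 0 - e₁ - z) - f := by
  obtain ⟨w, hzw, hw⟩ := h
  have hdown : coordAL e₁ e₂ (-e₂) = 0 := by
    rw [map_neg, neg_eq_zero]
    exact coordA_e₂
  have hunit : (-coordBL e₁ e₂) (-e₂) = 1 := by
    rw [neg_apply, map_neg, neg_neg]
    exact coordB_e₂ he.ne'
  rw [StokesCell.kernelIntegral_add_kernelIntegral (A := coordAL e₁ e₂) (B := -coordBL e₁ e₂)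
    hc hce (coordA_e₁ he.ne') hdown hunit hcA hz hzw (fun x hx => neg_lt_neg (hw x hx)) f]
  have hcross : ∀ u, cross u e₂ = coordA e₁ e₂ u * cross e₁ e₂ := fun u =>
    (div_mul_cancel₀ _ he.ne').symm
  have hright : 0 < cross (c 0 + e₁ - z) e₂ := by
    rw [hcross, hc0, coordA_sub, coordA_add, coordA_corner he.ne', coordA_e₁ he.ne']
    exact mul_pos (by linarith [hz.2]) he
  have hleft : cross (c 0 - e₁ - z) e₂ < 0 := by
    rw [hcross, hc0, coordA_sub, coordA_sub, coordA_corner he.ne', coordA_e₁ he.ne']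
    exact mul_neg_of_neg_of_pos (by linarith [hz.1]) he
  rw [sourcePotential_neg_of_pos hright, sourcePotential_neg_of_neg hleft]
  module

end

section

variable {e₁ e₂ : Plane} {c : ℝ → Plane} {z : Plane}

/-- The four vertices of a unit square of the index lattice: the lattice images in the expanded cell
of a point of its lower left quarter. -/
def unitSquare : Finset (ℤ × ℤ) := {0, 1} ×ˢ {0, 1}

theorem sum_unitSquare_latticeVec (K : Plane → Plane) :
    ∑ j ∈ unitSquare, K (z + latticeVec e₁ e₂ j.1 j.2) =
      (K z + K (z + e₁)) + (K (z + e₂) + K (z + e₂ + e₁)) := by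
  have h : ∀ x : Plane, x + e₂ + e₁ = x + (e₁ + e₂) := fun x => by abel
  simp only [unitSquare, Finset.sum_product_right, Finset.sum_pair (zero_ne_one' ℤ), latticeVec,
    Int.cast_zero, Int.cast_one, zero_smul, one_smul, add_zero, zero_add, h]

/-- Each of the two rows of images sees only the end points of the curve, and the shifted walls are
arranged so as to have the same end points. -/
theorem sum_kernelIntegral_latticeVec (he : 0 < cross e₁ e₂) (hc : IsRectifiableCurve c)
    (hc0 : c 0 = corner e₁ e₂) (hce : c 1 = c 0 + e₁)
    (hcA : ∀ t ∈ Icc (0 : ℝ) 1, coordA e₁ e₂ (c t) ∈ Ico (-1 : ℝ) 1)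
    (hz : z ∈ lowerLeftCell e₁ e₂) {s : ℝ}
    (hs : LiesAbove e₁ e₂ c z ∧ s = 0 ∨ LiesBelow e₁ e₂ c z ∧ s = 1)
    (hz₂ : LiesAbove e₁ e₂ c (z + e₂)) (f : Plane) :
    ∑ j ∈ unitSquare, kernelIntegral c (z + latticeVec e₁ e₂ j.1 j.2) f =
      shiftedWallSum e₁ e₂ (fun b => kernelIntegral b z f) - s • f := by
  have lower_row : kernelIntegral c z f + kernelIntegral c (z + e₁) f =
      sourcePotential e₂ f (c 0 + e₁ - z) - sourcePotential e₂ f (c 0 - e₁ - z) - s • f := by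
    rcases hs with ⟨hs, rfl⟩ | ⟨hs, rfl⟩
    · rw [hs.kernelIntegral_add_kernelIntegral he.ne' hc hce hcA hz.1, zero_smul, sub_zero]
    · rw [hs.kernelIntegral_add_kernelIntegral he hc hc0 hce hcA hz.1, one_smul]
  have hz₂A : coordA e₁ e₂ (z + e₂) ∈ Ico (-1 : ℝ) 0 := by
    rw [coordA_add, coordA_e₂, add_zero]
    exact hz.1
  have upper_row := hz₂.kernelIntegral_add_kernelIntegral he.ne' hc hce hcA hz₂A f
  rw [sum_unitSquare_latticeVec fun x => kernelIntegral c x f, lower_row, upper_row,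
    shiftedWallSum_kernelIntegral he.ne' hz,
    shiftedWallSum_sub_endpoints fun x => sourcePotential e₂ f (x - z), hc0]
  simp only [sub_add_eq_sub_sub_swap]
  abel

end

/-! ### Line integrals of tractions -/

theorem perp_smul (a : ℝ) (x : Plane) : perp (a • x) = a • perp x := by
  ext i
  fin_cases i <;> simp [perp]

theorem tractionIntegral_eq_integral_perp_deriv (c : ℝ → Plane) {T : Plane → Plane → Plane}
    (hT : ∀ x (a : ℝ) n, T x (a • n) = a • T x n) :
    tractionIntegral c T = ∫ t in (0 : ℝ)..1, T (c t) (perp (deriv c t)) := by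
  refine intervalIntegral.integral_congr fun t _ => ?_
  simp only [unitNormal, perp_smul, hT]
  rcases eq_or_ne (deriv c t) 0 with h | h
  · have hperp : perp (0 : Plane) = 0 := by simpa only [zero_smul] using perp_smul 0 0
    have hT0 : T (c t) 0 = 0 := by simpa only [zero_smul] using hT (c t) 0 0
    rw [h, hperp, hT0, smul_zero, smul_zero]
  · rw [smul_inv_smul₀ (norm_ne_zero_iff.2 h)]

/-! ### Path independence of the traction integral of a Stokes pair -/

section

variable (μ : ℝ) (u : Plane → Plane) (p : Plane → ℝ)

theorem traction_smul (x : Plane) (a : ℝ) (n : Plane) :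
    traction μ u p x (a • n) = a • traction μ u p x n := by
  ext i
  simp only [traction, PiLp.smul_apply, smul_eq_mul, Finset.mul_sum, mul_left_comm]

/-- The column `j` of the stress tensor. -/
def stressColumn (j : Fin 2) (x : Plane) : Plane := WithLp.toLp 2 fun i => stress μ u p x i j

/-- The traction with respect to the normal of a directed line element, as a `1`-form. -/
def tractionForm (x : Plane) : Plane →L[ℝ] Plane :=
  (EuclideanSpace.proj 0 : Plane →L[ℝ] ℝ).smulRight (stressColumn μ u p 1 x) -
    (EuclideanSpace.proj 1 : Plane →L[ℝ] ℝ).smulRight (stressColumn μ u p 0 x)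

theorem tractionForm_apply (x h : Plane) :
    tractionForm μ u p x h = traction μ u p x (perp h) := by
  ext i
  simp [tractionForm, traction, perp, stressColumn, Fin.sum_univ_two]
  ring

end

section

variable {μ : ℝ} {u : Plane → Plane} {p : Plane → ℝ} {x : Plane}

theorem laplacian_eq_sum_fderiv_fderiv_single :
    Δ u x = ∑ i : Fin 2, fderiv ℝ (fderiv ℝ u) x (EuclideanSpace.single i 1)
      (EuclideanSpace.single i 1) := by
  rw [InnerProductSpace.laplacian_eq_iteratedFDeriv_orthonormalBasis u
    (EuclideanSpace.basisFun (Fin 2) ℝ)]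
  simp [iteratedFDeriv_two_apply]

theorem gradient_apply_eq_fderiv_single (i : Fin 2) :
    (∇ p x) i = fderiv ℝ p x (EuclideanSpace.single i 1) := by
  have h : ⟪∇ p x, EuclideanSpace.single i (1 : ℝ)⟫_ℝ = fderiv ℝ p x (EuclideanSpace.single i 1) :=
    InnerProductSpace.toDual_symm_apply
  rw [← h, EuclideanSpace.inner_single_right]
  simp

theorem hasFDerivAt_pderiv (hu : ContDiffAt ℝ 2 u x) (j i : Fin 2) :
    HasFDerivAt (pderiv u j i) ((EuclideanSpace.proj i : Plane →L[ℝ] ℝ) ∘L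
      (fderiv ℝ (fderiv ℝ u) x).flip (EuclideanSpace.single j 1)) x := by
  have hd : DifferentiableAt ℝ (fderiv ℝ u) x :=
    (hu.fderiv_right (m := 1) one_add_one_eq_two.le).differentiableAt one_ne_zero
  exact (EuclideanSpace.proj i : Plane →L[ℝ] ℝ).hasFDerivAt.comp x
    ((ContinuousLinearMap.apply ℝ Plane
      (EuclideanSpace.single j (1 : ℝ) : Plane)).hasFDerivAt.comp x hd.hasFDerivAt)

theorem hasFDerivAt_stress (hu : ContDiffAt ℝ 2 u x) (hp : DifferentiableAt ℝ p x) (i j : Fin 2) :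
    HasFDerivAt (fun y => stress μ u p y i j) ((if i = j then -fderiv ℝ p x else 0) +
      μ • ((EuclideanSpace.proj i : Plane →L[ℝ] ℝ) ∘L
        (fderiv ℝ (fderiv ℝ u) x).flip (EuclideanSpace.single j 1) +
      (EuclideanSpace.proj j : Plane →L[ℝ] ℝ) ∘L
        (fderiv ℝ (fderiv ℝ u) x).flip (EuclideanSpace.single i 1))) x := by
  simp only [stress, Matrix.of_apply]
  refine HasFDerivAt.add ?_
    (((hasFDerivAt_pderiv hu j i).add (hasFDerivAt_pderiv hu i j)).const_mul μ)
  split_ifs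
  · exact hp.hasFDerivAt.neg
  · exact hasFDerivAt_const 0 x

theorem differentiableAt_stressColumn (hu : ContDiffAt ℝ 2 u x) (hp : DifferentiableAt ℝ p x)
    (j : Fin 2) : DifferentiableAt ℝ (stressColumn μ u p j) x :=
  differentiableAt_euclidean.2 fun i => (hasFDerivAt_stress hu hp i j).differentiableAt

theorem fderiv_stressColumn_apply (hu : ContDiffAt ℝ 2 u x) (hp : DifferentiableAt ℝ p x)
    (i j : Fin 2) (k : Plane) :
    (fderiv ℝ (stressColumn μ u p j) x k) i = (if i = j then -fderiv ℝ p x k else 0) +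
      μ * ((fderiv ℝ (fderiv ℝ u) x k (EuclideanSpace.single j 1)) i +
        (fderiv ℝ (fderiv ℝ u) x k (EuclideanSpace.single i 1)) j) := by
  have h := ((EuclideanSpace.proj i : Plane →L[ℝ] ℝ).hasFDerivAt.comp x
    (differentiableAt_stressColumn (μ := μ) hu hp j).hasFDerivAt).unique
      (hasFDerivAt_stress hu hp i j)
  refine (DFunLike.congr_fun h k).trans ?_
  split_ifs <;> rfl

theorem sum_fderiv_fderiv_single_apply_eq_zero (hu : ContDiffAt ℝ 2 u x)
    (hdiv : ∀ᶠ y in 𝓝 x, ∑ i, pderiv u i i y = 0) (k : Plane) :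
    ∑ i, (fderiv ℝ (fderiv ℝ u) x k (EuclideanSpace.single i 1)) i = 0 := by
  have hsum : HasFDerivAt (fun y => ∑ i, pderiv u i i y) _ x :=
    HasFDerivAt.fun_sum fun i _ => hasFDerivAt_pderiv hu i i
  have hzero : HasFDerivAt (fun y => ∑ i, pderiv u i i y) (0 : Plane →L[ℝ] ℝ) x :=
    (hasFDerivAt_const 0 x).congr_of_eventuallyEq hdiv
  simpa using DFunLike.congr_fun (hsum.unique hzero) k

theorem sum_fderiv_stressColumn_single (hu : ContDiffAt ℝ 2 u x) (hp : DifferentiableAt ℝ p x)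
    (hdiv : ∀ᶠ y in 𝓝 x, ∑ i, pderiv u i i y = 0) :
    ∑ j, fderiv ℝ (stressColumn μ u p j) x (EuclideanSpace.single j 1) = μ • Δ u x - ∇ p x := by
  have hsymm : ∀ a b, fderiv ℝ (fderiv ℝ u) x a b = fderiv ℝ (fderiv ℝ u) x b a :=
    (hu.isSymmSndFDerivAt (by simp)).eq
  ext i
  have hdiv_i : ∑ j : Fin 2, (fderiv ℝ (fderiv ℝ u) x (EuclideanSpace.single j 1)
      (EuclideanSpace.single i 1)) j = 0 := by
    simpa only [hsymm _ (EuclideanSpace.single i 1)] using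
      sum_fderiv_fderiv_single_apply_eq_zero hu hdiv (EuclideanSpace.single i 1)
  simp only [WithLp.ofLp_sum, Finset.sum_apply, fderiv_stressColumn_apply hu hp,
    Finset.sum_add_distrib, ← Finset.mul_sum, hdiv_i, Finset.sum_ite_eq, Finset.mem_univ, if_true,
    PiLp.sub_apply, PiLp.smul_apply, smul_eq_mul, gradient_apply_eq_fderiv_single,
    laplacian_eq_sum_fderiv_fderiv_single]
  ring

theorem hasFDerivAt_tractionForm (hu : ContDiffAt ℝ 2 u x) (hp : DifferentiableAt ℝ p x) :
    HasFDerivAt (tractionForm μ u p)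
      ((ContinuousLinearMap.smulRightL ℝ Plane Plane (EuclideanSpace.proj 0)) ∘L
          fderiv ℝ (stressColumn μ u p 1) x -
        (ContinuousLinearMap.smulRightL ℝ Plane Plane (EuclideanSpace.proj 1)) ∘L
          fderiv ℝ (stressColumn μ u p 0) x) x := by
  have h := fun j => (differentiableAt_stressColumn (μ := μ) hu hp j).hasFDerivAt
  exact ((ContinuousLinearMap.smulRightL ℝ Plane Plane
      (EuclideanSpace.proj 0)).hasFDerivAt.comp x (h 1)).sub
    ((ContinuousLinearMap.smulRightL ℝ Plane Plane
      (EuclideanSpace.proj 1)).hasFDerivAt.comp x (h 0))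

theorem fderiv_tractionForm_symm (hu : ContDiffAt ℝ 2 u x) (hp : DifferentiableAt ℝ p x)
    (hdiv : ∀ᶠ y in 𝓝 x, ∑ i, pderiv u i i y = 0) (hmom : μ • Δ u x = ∇ p x) (a b : Plane) :
    fderiv ℝ (tractionForm μ u p) x a b = fderiv ℝ (tractionForm μ u p) x b a := by
  have hcol := sum_fderiv_stressColumn_single (μ := μ) hu hp hdiv
  rw [hmom, sub_self, Fin.sum_univ_two] at hcol
  have hbasis : ∀ (A : Plane →L[ℝ] Plane) (k : Plane), A k =
      k 0 • A (EuclideanSpace.single 0 1) + k 1 • A (EuclideanSpace.single 1 1) := by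
    intro A k
    rw [← map_smul, ← map_smul, ← map_add]
    congr 1
    ext i
    fin_cases i <;> simp
  rw [(hasFDerivAt_tractionForm hu hp).fderiv]
  simp only [sub_apply, ContinuousLinearMap.comp_apply,
    ContinuousLinearMap.smulRightL_apply_apply, ContinuousLinearMap.smulRight_apply]
  simp only [hbasis (fderiv ℝ (stressColumn μ u p _) x) a,
    hbasis (fderiv ℝ (stressColumn μ u p _) x) b, eq_neg_of_add_eq_zero_left hcol, PiLp.proj_apply]
  module

end

namespace IsStokesPair

variable {μ : ℝ} {W : Set Plane} {u : Plane → Plane} {p : Plane → ℝ} {x : Plane}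

theorem contDiffAt_two (h : IsStokesPair μ W u p) (hW : IsOpen W) (hx : x ∈ W) :
    ContDiffAt ℝ 2 u x :=
  (h.1.contDiffAt (hW.mem_nhds hx)).of_le
    (WithTop.coe_le_coe.2 (le_top : (2 : ℕ∞) ≤ ⊤))

theorem differentiableAt_pressure (h : IsStokesPair μ W u p) (hW : IsOpen W) (hx : x ∈ W) :
    DifferentiableAt ℝ p x :=
  (h.2.1.contDiffAt (hW.mem_nhds hx)).differentiableAt (by simp)

theorem differentiableAt_tractionForm (h : IsStokesPair μ W u p) (hW : IsOpen W) (hx : x ∈ W) :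
    DifferentiableAt ℝ (tractionForm μ u p) x :=
  (hasFDerivAt_tractionForm (h.contDiffAt_two hW hx)
    (h.differentiableAt_pressure hW hx)).differentiableAt

theorem continuousOn_tractionForm_comp (h : IsStokesPair μ W u p) (hW : IsOpen W) {c : ℝ → Plane}
    (hc : IsRectifiableCurve c) (hcW : ∀ t ∈ Icc (0 : ℝ) 1, c t ∈ W) :
    ContinuousOn (fun t => tractionForm μ u p (c t)) (Icc 0 1) := fun t ht =>
  (h.differentiableAt_tractionForm hW (hcW t ht)).continuousAt.comp_continuousWithinAt
    (hc.continuousOn t ht)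

theorem intervalIntegrable_traction (h : IsStokesPair μ W u p) (hW : IsOpen W) {c : ℝ → Plane}
    (hc : IsRectifiableCurve c) (hcW : ∀ t ∈ Icc (0 : ℝ) 1, c t ∈ W) :
    IntervalIntegrable (fun t => traction μ u p (c t) (perp (deriv c t))) volume 0 1 := by
  simp only [← tractionForm_apply]
  exact hc.intervalIntegrable_clm_apply (h.continuousOn_tractionForm_comp hW hc hcW)

/-- The momentum and continuity equations say that the traction form is closed. -/
theorem exists_hasFDerivAt_tractionForm (h : IsStokesPair μ W u p) (hW : IsOpen W)
    (hWc : Convex ℝ W) : ∃ F : Plane → Plane, ∀ x ∈ W, HasFDerivAt F (tractionForm μ u p x) x :=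
  hWc.exists_forall_hasFDerivAt_of_fderiv_symmetric hW
    (fun _ hx => (h.differentiableAt_tractionForm hW hx).differentiableWithinAt)
    fun x hx a b => fderiv_tractionForm_symm (h.contDiffAt_two hW hx)
      (h.differentiableAt_pressure hW hx)
      (mem_of_superset (hW.mem_nhds hx) fun y hy => (h.2.2 y hy).2)
      (neg_add_eq_zero.1 (h.2.2 x hx).1) a b

theorem integral_traction_eq_of_endpoints_eq (h : IsStokesPair μ W u p) (hW : IsOpen W)
    (hWc : Convex ℝ W) {c c' : ℝ → Plane} (hc : IsRectifiableCurve c)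
    (hcW : ∀ t ∈ Icc (0 : ℝ) 1, c t ∈ W) (hc' : IsRectifiableCurve c')
    (hcW' : ∀ t ∈ Icc (0 : ℝ) 1, c' t ∈ W) (h0 : c 0 = c' 0) (h1 : c 1 = c' 1) :
    ∫ t in (0 : ℝ)..1, traction μ u p (c t) (perp (deriv c t)) =
      ∫ t in (0 : ℝ)..1, traction μ u p (c' t) (perp (deriv c' t)) := by
  obtain ⟨F, hF⟩ := h.exists_hasFDerivAt_tractionForm hW hWc
  simp only [← tractionForm_apply]
  rw [hc.integral_eq_sub_of_hasFDerivAt (fun t ht => hF _ (hcW t ht))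
      (h.continuousOn_tractionForm_comp hW hc hcW),
    hc'.integral_eq_sub_of_hasFDerivAt (fun t ht => hF _ (hcW' t ht))
      (h.continuousOn_tractionForm_comp hW hc' hcW'), h0, h1]

end IsStokesPair

/-! ### Exchanging the integrals over sources and targets -/

theorem continuous_perp : Continuous perp := by
  unfold perp
  fun_prop

theorem norm_perp (x : Plane) : ‖perp x‖ = ‖x‖ := by
  rw [EuclideanSpace.norm_eq, EuclideanSpace.norm_eq]
  simp [perp, add_comm]

theorem tractionKernel_smul (x : Plane) (a : ℝ) (n z f : Plane) :
    tractionKernel x (a • n) z f = a • tractionKernel x n z f := by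
  rw [tractionKernel, tractionKernel, inner_smul_right, smul_smul]
  congr 1
  ring

theorem norm_tractionKernel_le (x n z f : Plane) :
    ‖tractionKernel x n z f‖ ≤ ‖f‖ * ‖n‖ / ‖x - z‖ := by
  rcases eq_or_ne (x - z) 0 with h0 | h0
  · rw [tractionKernel, h0, smul_zero, norm_zero, div_zero]
  have hpi : |(-(1 / Real.pi))| ≤ 1 := by
    rw [abs_neg, abs_of_pos (by positivity), div_le_one Real.pi_pos]
    linarith [Real.pi_gt_three]
  have hf := abs_real_inner_le_norm (x - z) f
  have hn := abs_real_inner_le_norm (x - z) n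
  calc ‖tractionKernel x n z f‖
      = |(-(1 / Real.pi))| * (|⟪x - z, f⟫_ℝ| / ‖x - z‖ ^ 2) * (|⟪x - z, n⟫_ℝ| / ‖x - z‖ ^ 2)
          * ‖x - z‖ := by
        simp only [tractionKernel, norm_smul, norm_mul, norm_div, norm_pow,
          Real.norm_eq_abs, abs_norm]
    _ ≤ 1 * (‖x - z‖ * ‖f‖ / ‖x - z‖ ^ 2) * (‖x - z‖ * ‖n‖ / ‖x - z‖ ^ 2) * ‖x - z‖ := by gcongr
    _ = ‖f‖ * ‖n‖ / ‖x - z‖ := by field_simp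

theorem measurable_tractionKernel : Measurable
    (fun p : (Plane × Plane) × Plane × Plane => tractionKernel p.1.1 p.1.2 p.2.1 p.2.2) := by
  unfold tractionKernel
  fun_prop

section

variable {α : Type*} [MeasurableSpace α] {ν : Measure α} {φ f : α → Plane}

theorem integrable_tractionKernel (hφ : AEMeasurable φ ν) (hf : Integrable f ν) {δ : ℝ}
    (hδ : 0 < δ) {x : Plane} (hx : ∀ᵐ y ∂ν, δ ≤ ‖x - φ y‖) (n : Plane) :
    Integrable (fun y => tractionKernel x n (φ y) (f y)) ν := by
  refine (hf.norm.mul_const (‖n‖ / δ)).mono' ?_ ?_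
  · exact (measurable_tractionKernel.comp_aemeasurable (f := fun y => ((x, n), (φ y, f y)))
      (aemeasurable_const.prodMk (hφ.prodMk hf.aemeasurable))).aestronglyMeasurable
  · filter_upwards [hx] with y hy
    refine (norm_tractionKernel_le _ _ _ _).trans ?_
    rw [← mul_div_assoc]
    gcongr

/-- The source point `φ y` stays at a positive distance from the curve `c`, uniformly for almost
every `y`. -/
def IsAwayFrom (ν : Measure α) (φ : α → Plane) (c : ℝ → Plane) : Prop :=
  ∃ δ > 0, ∀ᵐ y ∂ν, ∀ t ∈ Icc (0 : ℝ) 1, δ ≤ ‖c t - φ y‖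

namespace IsAwayFrom

variable {c : ℝ → Plane}

theorem integrable_tractionKernel (h : IsAwayFrom ν φ c) (hφ : AEMeasurable φ ν)
    (hf : Integrable f ν) {t : ℝ} (ht : t ∈ Icc (0 : ℝ) 1) (n : Plane) :
    Integrable (fun y => tractionKernel (c t) n (φ y) (f y)) ν := by
  obtain ⟨δ, hδ, h⟩ := h
  exact StokesCell.integrable_tractionKernel hφ hf hδ (h.mono fun _ hy => hy t ht) n

theorem integrable_prod (h : IsAwayFrom ν φ c) (hφ : AEMeasurable φ ν) (hf : Integrable f ν)
    (hc : IsRectifiableCurve c) :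
    Integrable (fun p : ℝ × α => tractionKernel (c p.1) (perp (deriv c p.1)) (φ p.2) (f p.2))
      (((volume : Measure ℝ).restrict (Ioc 0 1)).prod ν) := by
  obtain ⟨δ, hδ, h⟩ := h
  set τ := (volume : Measure ℝ).restrict (Ioc 0 1)
  have hderiv : Integrable (fun t => ‖deriv c t‖) τ :=
    ((intervalIntegrable_iff_integrableOn_Ioc_of_le zero_le_one).1
      hc.intervalIntegrable_deriv).norm
  refine ((hderiv.mul_prod hf.norm).mul_const δ⁻¹).mono' ?_ ?_
  · have htarget : AEMeasurable (fun t => (c t, perp (deriv c t))) τ :=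
      ((hc.continuousOn.mono Ioc_subset_Icc_self).aemeasurable measurableSet_Ioc).prodMk
        (continuous_perp.measurable.comp (measurable_deriv c)).aemeasurable
    exact (measurable_tractionKernel.comp_aemeasurable
      ((htarget.comp_quasiMeasurePreserving Measure.quasiMeasurePreserving_fst).prodMk
        ((hφ.prodMk hf.aemeasurable).comp_quasiMeasurePreserving
          Measure.quasiMeasurePreserving_snd))).aestronglyMeasurable
  · filter_upwards [Measure.quasiMeasurePreserving_fst.ae (ae_restrict_mem measurableSet_Ioc),
      Measure.quasiMeasurePreserving_snd.ae h] with p hp hδp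
    calc _ ≤ ‖f p.2‖ * ‖perp (deriv c p.1)‖ / ‖c p.1 - φ p.2‖ := norm_tractionKernel_le _ _ _ _
      _ ≤ ‖f p.2‖ * ‖perp (deriv c p.1)‖ / δ := by
        gcongr
        exact hδp _ (Ioc_subset_Icc_self hp)
      _ = ‖deriv c p.1‖ * ‖f p.2‖ * δ⁻¹ := by
        rw [norm_perp, div_eq_mul_inv, mul_comm ‖f p.2‖]

variable [SFinite ν]

theorem intervalIntegrable_integral (h : IsAwayFrom ν φ c) (hφ : AEMeasurable φ ν)
    (hf : Integrable f ν) (hc : IsRectifiableCurve c) :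
    IntervalIntegrable (fun t => ∫ y, tractionKernel (c t) (perp (deriv c t)) (φ y) (f y) ∂ν)
      volume 0 1 :=
  (intervalIntegrable_iff_integrableOn_Ioc_of_le zero_le_one).2
    (h.integrable_prod hφ hf hc).integral_prod_left

theorem integrable_kernelIntegral (h : IsAwayFrom ν φ c) (hφ : AEMeasurable φ ν)
    (hf : Integrable f ν) (hc : IsRectifiableCurve c) :
    Integrable (fun y => kernelIntegral c (φ y) (f y)) ν := by
  simpa only [kernelIntegral, intervalIntegral.integral_of_le zero_le_one] using!
    (h.integrable_prod hφ hf hc).integral_prod_right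

theorem integral_integral_tractionKernel (h : IsAwayFrom ν φ c) (hφ : AEMeasurable φ ν)
    (hf : Integrable f ν) (hc : IsRectifiableCurve c) :
    ∫ t in (0 : ℝ)..1, ∫ y, tractionKernel (c t) (perp (deriv c t)) (φ y) (f y) ∂ν =
      ∫ y, kernelIntegral c (φ y) (f y) ∂ν := by
  simp only [kernelIntegral, intervalIntegral.integral_of_le zero_le_one]
  exact integral_integral_swap (h.integrable_prod hφ hf hc)

end IsAwayFrom

end

/-! ### Folding the expanded cell onto its lower left quarter -/

section

variable {e₁ e₂ : Plane}

theorem coordA_latticeVec (he : cross e₁ e₂ ≠ 0) (m k : ℤ) :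
    coordA e₁ e₂ (latticeVec e₁ e₂ m k) = m := by
  rw [latticeVec, coordA_add, coordA_smul, coordA_smul, coordA_e₁ he, coordA_e₂, mul_one, mul_zero,
    add_zero]

theorem coordB_latticeVec (he : cross e₁ e₂ ≠ 0) (m k : ℤ) :
    coordB e₁ e₂ (latticeVec e₁ e₂ m k) = k := by
  rw [latticeVec, coordB_add, coordB_smul, coordB_smul, coordB_e₁, coordB_e₂ he, mul_one, mul_zero,
    zero_add]

/-- The lattice image of `y` in the lower left cell. On the four pieces of a boundary contained in
the expanded cell this is the subtraction of the vectors `pieceShift`. -/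
def fold (e₁ e₂ y : Plane) : Plane :=
  y - latticeVec e₁ e₂ (⌊coordA e₁ e₂ y⌋ + 1) (⌊coordB e₁ e₂ y⌋ + 1)

theorem fold_mem_lowerLeftCell (he : cross e₁ e₂ ≠ 0) (y : Plane) :
    fold e₁ e₂ y ∈ lowerLeftCell e₁ e₂ := by
  have key : ∀ a : ℝ, a - ((⌊a⌋ + 1 : ℤ) : ℝ) ∈ Ico (-1 : ℝ) 0 := fun a => by
    push_cast
    exact ⟨by linarith [Int.floor_le a], by linarith [Int.lt_floor_add_one a]⟩
  rw [fold, lowerLeftCell, mem_ofPred_eq, coordA_sub, coordB_sub, coordA_latticeVec he,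
    coordB_latticeVec he]
  exact ⟨key _, key _⟩

theorem measurable_fold : Measurable (fold e₁ e₂) := by
  have hA : Measurable (coordA e₁ e₂) := (coordAL e₁ e₂).measurable
  have hB : Measurable (coordB e₁ e₂) := (coordBL e₁ e₂).measurable
  have hfloor : Measurable fun a : ℝ => ((⌊a⌋ + 1 : ℤ) : ℝ) :=
    (measurable_of_countable fun n : ℤ => ((n + 1 : ℤ) : ℝ)).comp Int.measurable_floor
  exact measurable_id.sub
    (((hfloor.comp hA).smul_const e₁).add ((hfloor.comp hB).smul_const e₂))

theorem add_latticeVec_mem_expandedCell_iff (he : cross e₁ e₂ ≠ 0) {z : Plane}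
    (hz : z ∈ lowerLeftCell e₁ e₂) (j : ℤ × ℤ) :
    z + latticeVec e₁ e₂ j.1 j.2 ∈ expandedCell e₁ e₂ ↔ j ∈ unitSquare := by
  have key : ∀ (a : ℝ) (n : ℤ), a ∈ Ico (-1 : ℝ) 0 →
      (a + n ∈ Ico (-1 : ℝ) 1 ↔ n = 0 ∨ n = 1) := by
    rintro a n ⟨ha, ha'⟩
    constructor
    · rintro ⟨hn, hn'⟩
      have hn₀ : -1 < n := by exact_mod_cast (by linarith : (-1 : ℝ) < n)
      have hn₁ : n < 2 := by exact_mod_cast (by linarith : (n : ℝ) < 2)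
      omega
    · rintro (rfl | rfl) <;> push_cast <;> constructor <;> linarith
  rw [expandedCell, mem_ofPred_eq, coordA_add, coordB_add, coordA_latticeVec he,
    coordB_latticeVec he, key _ _ hz.1, key _ _ hz.2]
  simp only [unitSquare, Finset.mem_product, Finset.mem_insert, Finset.mem_singleton]

theorem nearSum_eq_sum_fold (he : cross e₁ e₂ ≠ 0) (K : Plane → Plane) (y : Plane) :
    nearSum e₁ e₂ K y = ∑ j ∈ unitSquare, K (fold e₁ e₂ y + latticeVec e₁ e₂ j.1 j.2) := by
  set a : ℤ × ℤ := (⌊coordA e₁ e₂ y⌋ + 1, ⌊coordB e₁ e₂ y⌋ + 1) with ha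
  have hy : ∀ k : ℤ × ℤ, y + latticeVec e₁ e₂ k.1 k.2 =
      fold e₁ e₂ y + latticeVec e₁ e₂ (a + k).1 (a + k).2 := fun k => by
    simp only [fold, ha, latticeVec, Prod.fst_add, Prod.snd_add, Int.cast_add]
    module
  calc nearSum e₁ e₂ K y
      = ∑ᶠ k : ℤ × ℤ, ∑ᶠ _ : fold e₁ e₂ y + latticeVec e₁ e₂ (a + k).1 (a + k).2 ∈
          expandedCell e₁ e₂, K (fold e₁ e₂ y + latticeVec e₁ e₂ (a + k).1 (a + k).2) := by
        simp only [nearSum, hy]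
    _ = ∑ᶠ j : ℤ × ℤ, ∑ᶠ _ : fold e₁ e₂ y + latticeVec e₁ e₂ j.1 j.2 ∈ expandedCell e₁ e₂,
          K (fold e₁ e₂ y + latticeVec e₁ e₂ j.1 j.2) :=
        finsum_comp_equiv (Equiv.addLeft a)
          (f := fun j => ∑ᶠ _ : fold e₁ e₂ y + latticeVec e₁ e₂ j.1 j.2 ∈ expandedCell e₁ e₂,
            K (fold e₁ e₂ y + latticeVec e₁ e₂ j.1 j.2))
    _ = _ := by
        simp only [add_latticeVec_mem_expandedCell_iff he (fold_mem_lowerLeftCell he y)]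
        exact finsum_mem_finset_eq_sum _ _

/-! ### Lattice images above and below the periodic curve -/

variable {c : ℝ → Plane} {x : Plane}

theorem add_zsmul_mem_periodicCurve_iff (m : ℤ) :
    x + (m : ℝ) • e₁ ∈ periodicCurve e₁ c ↔ x ∈ periodicCurve e₁ c := by
  constructor
  · rintro ⟨l, t, ht, h⟩
    refine ⟨l - m, t, ht, ?_⟩
    rw [eq_sub_of_add_eq h, Int.cast_sub]
    module
  · rintro ⟨l, t, ht, rfl⟩
    refine ⟨l + m, t, ht, ?_⟩
    rw [Int.cast_add]
    module

theorem joinedIn_compl_periodicCurve_add_zsmul {y : Plane}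
    (h : JoinedIn (periodicCurve e₁ c)ᶜ x y) (m : ℤ) :
    JoinedIn (periodicCurve e₁ c)ᶜ (x + (m : ℝ) • e₁) (y + (m : ℝ) • e₁) := by
  obtain ⟨γ, hγ⟩ := h
  exact ⟨γ.map (continuous_add_const ((m : ℝ) • e₁)), fun s hs =>
    hγ s ((add_zsmul_mem_periodicCurve_iff m).1 hs)⟩

theorem LiesAbove.add_zsmul (h : LiesAbove e₁ e₂ c x) (m : ℤ) :
    LiesAbove e₁ e₂ c (x + (m : ℝ) • e₁) := by
  obtain ⟨y, hxy, hy⟩ := h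
  refine ⟨y + (m : ℝ) • e₁, joinedIn_compl_periodicCurve_add_zsmul hxy m, fun w hw => ?_⟩
  rw [coordB_add, coordB_smul, coordB_e₁, mul_zero, add_zero]
  exact hy w hw

theorem LiesBelow.add_zsmul (h : LiesBelow e₁ e₂ c x) (m : ℤ) :
    LiesBelow e₁ e₂ c (x + (m : ℝ) • e₁) := by
  obtain ⟨y, hxy, hy⟩ := h
  refine ⟨y + (m : ℝ) • e₁, joinedIn_compl_periodicCurve_add_zsmul hxy m, fun w hw => ?_⟩
  rw [coordB_add, coordB_smul, coordB_e₁, mul_zero, add_zero]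
  exact hy w hw

theorem add_latticeVec_eq_add_zsmul (y : Plane) (m k : ℤ) :
    y + latticeVec e₁ e₂ m k = y + latticeVec e₁ e₂ 0 k + (m : ℝ) • e₁ := by
  rw [latticeVec, latticeVec, Int.cast_zero]
  module

namespace IsDeformedBottomWall

variable {Γ Ω : Set Plane}

theorem mono (h : IsDeformedBottomWall e₁ e₂ Ω c) (hΓ : closure Γ ⊆ closure Ω) :
    IsDeformedBottomWall e₁ e₂ Γ c where
  piecewiseC1 := h.piecewiseC1
  start := h.start
  finish := h.finish
  above k hk x hx := h.above k hk x (hΓ hx)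
  below k hk x hx := h.below k hk x (hΓ hx)

theorem liesAbove (h : IsDeformedBottomWall e₁ e₂ Γ c) {y : Plane} (hy : y ∈ closure Γ) (m : ℤ)
    {k : ℤ} (hk : 0 ≤ k) : LiesAbove e₁ e₂ c (y + latticeVec e₁ e₂ m k) := by
  rw [add_latticeVec_eq_add_zsmul]
  exact (h.above k hk y hy).add_zsmul m

theorem liesBelow (h : IsDeformedBottomWall e₁ e₂ Γ c) {y : Plane} (hy : y ∈ closure Γ) (m : ℤ)
    {k : ℤ} (hk : k < 0) : LiesBelow e₁ e₂ c (y + latticeVec e₁ e₂ m k) := by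
  rw [add_latticeVec_eq_add_zsmul]
  exact (h.below k hk y hy).add_zsmul m

theorem start_eq_corner (h : IsDeformedBottomWall e₁ e₂ Γ c) : c 0 = corner e₁ e₂ := by
  rw [h.start, wallD, seg, zero_smul, add_zero]

theorem finish_eq_start_add (h : IsDeformedBottomWall e₁ e₂ Γ c) : c 1 = c 0 + e₁ := by
  rw [h.start_eq_corner, h.finish, wallD, seg, one_smul]

/-- The row of images through the lower left cell lies below the curve exactly for the sources that
the folding moves down by `e₂`. -/
theorem sum_kernelIntegral_fold (h : IsDeformedBottomWall e₁ e₂ Γ c) (he : 0 < cross e₁ e₂)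
    (hΓ : Γ ⊆ expandedCell e₁ e₂)
    (hcA : ∀ t ∈ Icc (0 : ℝ) 1, coordA e₁ e₂ (c t) ∈ Ico (-1 : ℝ) 1)
    (σ : Plane → Plane) {y : Plane} (hy : y ∈ Γ) :
    ∑ j ∈ unitSquare, kernelIntegral c (fold e₁ e₂ y + latticeVec e₁ e₂ j.1 j.2) (σ y) =
      shiftedWallSum e₁ e₂ (fun b => kernelIntegral b (fold e₁ e₂ y) (σ y)) -
        {x | 0 ≤ coordB e₁ e₂ x}.indicator σ y := by
  have hy' : y ∈ closure Γ := subset_closure hy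
  obtain ⟨-, hB, hB'⟩ := hΓ hy
  set m := ⌊coordA e₁ e₂ y⌋
  set k := ⌊coordB e₁ e₂ y⌋
  have hk₀ : -1 ≤ k := Int.le_floor.2 (by exact_mod_cast hB)
  have hk₁ : k < 1 := Int.floor_lt.2 (by exact_mod_cast hB')
  have hz : fold e₁ e₂ y = y + latticeVec e₁ e₂ (-(m + 1)) (-(k + 1)) := by
    simp only [fold, latticeVec, Int.cast_neg]
    module
  have hz₂ : fold e₁ e₂ y + e₂ = y + latticeVec e₁ e₂ (-(m + 1)) (-k) := by
    simp only [fold, latticeVec, Int.cast_neg, Int.cast_add, Int.cast_one]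
    module
  have upper : LiesAbove e₁ e₂ c (fold e₁ e₂ y + e₂) := hz₂ ▸ h.liesAbove hy' _ (by omega)
  have key := fun s hs => sum_kernelIntegral_latticeVec he
    (IsRectifiableCurve.of_isPiecewiseC1 h.piecewiseC1) h.start_eq_corner h.finish_eq_start_add hcA
    (fold_mem_lowerLeftCell he.ne' y) (s := s) hs upper (σ y)
  by_cases hy₀ : 0 ≤ coordB e₁ e₂ y
  · have hk' : 0 ≤ k := Int.le_floor.2 (by exact_mod_cast hy₀)
    have hmem : y ∈ {x | 0 ≤ coordB e₁ e₂ x} := hy₀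
    rw [key 1 (Or.inr ⟨hz ▸ h.liesBelow hy' _ (by omega), rfl⟩), one_smul, indicator_of_mem hmem]
  · have hk' : k < 0 := Int.floor_lt.2 (by exact_mod_cast not_le.1 hy₀)
    have hmem : y ∉ {x | 0 ≤ coordB e₁ e₂ x} := hy₀
    rw [key 0 (Or.inl ⟨hz ▸ h.liesAbove hy' _ (by omega), rfl⟩), zero_smul,
      indicator_of_notMem hmem]

end IsDeformedBottomWall

end

/-! ### The source curve and its shifted pieces -/

section

variable {e₁ e₂ : Plane} {Γ : Set Plane}

theorem measurableSet_nonneg_coordA : MeasurableSet {x | 0 ≤ coordA e₁ e₂ x} :=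
  measurableSet_le measurable_const (coordAL e₁ e₂).measurable

theorem measurableSet_nonneg_coordB : MeasurableSet {x | 0 ≤ coordB e₁ e₂ x} :=
  measurableSet_le measurable_const (coordBL e₁ e₂).measurable

theorem quadrant_eq_inter (i : Fin 4) : quadrant e₁ e₂ i =
    ![{x | 0 ≤ coordA e₁ e₂ x}, {x | 0 ≤ coordA e₁ e₂ x}ᶜ, {x | 0 ≤ coordA e₁ e₂ x}ᶜ,
        {x | 0 ≤ coordA e₁ e₂ x}] i ∩
      ![{x | 0 ≤ coordB e₁ e₂ x}, {x | 0 ≤ coordB e₁ e₂ x}, {x | 0 ≤ coordB e₁ e₂ x}ᶜ,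
        {x | 0 ≤ coordB e₁ e₂ x}ᶜ] i := by
  ext x
  fin_cases i <;> simp [quadrant]

theorem measurableSet_quadrant (i : Fin 4) : MeasurableSet (quadrant e₁ e₂ i) := by
  have hA := measurableSet_nonneg_coordA (e₁ := e₁) (e₂ := e₂)
  have hB := measurableSet_nonneg_coordB (e₁ := e₁) (e₂ := e₂)
  rw [quadrant_eq_inter]
  fin_cases i
  exacts [hA.inter hB, hA.compl.inter hB, hA.compl.inter hB.compl, hA.inter hB.compl]

theorem iUnion_piece (Γ : Set Plane) : ⋃ i, piece e₁ e₂ Γ i = Γ := by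
  refine subset_antisymm (iUnion_subset fun i => inter_subset_left) fun y hy => mem_iUnion.2 ?_
  rcases le_or_gt 0 (coordA e₁ e₂ y) with ha | ha <;>
    rcases le_or_gt 0 (coordB e₁ e₂ y) with hb | hb
  exacts [⟨0, hy, ha, hb⟩, ⟨3, hy, ha, hb⟩, ⟨1, hy, ha, hb⟩, ⟨2, hy, ha, hb⟩]

theorem pairwise_disjoint_piece (Γ : Set Plane) :
    Pairwise (Function.onFun Disjoint (piece e₁ e₂ Γ)) := by
  refine fun i j hij => Set.disjoint_left.2 ?_
  rintro y ⟨-, hi⟩ ⟨-, hj⟩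
  fin_cases i <;> fin_cases j <;>
    first
    | exact hij rfl
    | exact hi.1.not_gt hj.1
    | exact hj.1.not_gt hi.1
    | exact hi.2.not_gt hj.2
    | exact hj.2.not_gt hi.2

theorem netForce_upper_pieces (Γ : Set Plane) (σ : Plane → Plane) :
    netForce (piece e₁ e₂ Γ 0 ∪ piece e₁ e₂ Γ 1) σ =
      ∫ y in Γ, {x | 0 ≤ coordB e₁ e₂ x}.indicator σ y ∂μH[1] := by
  have hunion : piece e₁ e₂ Γ 0 ∪ piece e₁ e₂ Γ 1 = Γ ∩ {x | 0 ≤ coordB e₁ e₂ x} := by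
    simp only [piece, quadrant_eq_inter, ← inter_union_distrib_left]
    exact congrArg (Γ ∩ ·) ((union_inter_distrib_right _ _ _).symm.trans (by
      simp only [Matrix.cons_val_zero, Matrix.cons_val_one, union_compl_self, univ_inter]))
  rw [setIntegral_indicator measurableSet_nonneg_coordB, netForce, hunion]

theorem floor_add_one_mem {a : ℝ} (ha : a ∈ Ico (-1 : ℝ) 1) : ⌊a⌋ + 1 ∈ ({0, 1} : Finset ℤ) := by
  have h₀ : -1 ≤ ⌊a⌋ := Int.le_floor.2 (by exact_mod_cast ha.1)
  have h₁ : ⌊a⌋ < 1 := Int.floor_lt.2 (by exact_mod_cast ha.2)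
  rw [Finset.mem_insert, Finset.mem_singleton]
  omega

theorem exists_fold_eq {y : Plane} (hy : y ∈ expandedCell e₁ e₂) :
    ∃ a ∈ unitSquare, fold e₁ e₂ y = y - latticeVec e₁ e₂ a.1 a.2 :=
  ⟨(_, _), Finset.mk_mem_product (floor_add_one_mem hy.1) (floor_add_one_mem hy.2), rfl⟩

theorem fold_eq_sub_pieceShift {y : Plane} (hy : y ∈ expandedCell e₁ e₂) {i : Fin 4}
    (hi : y ∈ quadrant e₁ e₂ i) : fold e₁ e₂ y = y - pieceShift e₁ e₂ i := by
  have hneg : ∀ {a : ℝ}, -1 ≤ a → a < 0 → ⌊a⌋ = -1 := fun h h' =>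
    Int.floor_eq_iff.2 ⟨by exact_mod_cast h, by norm_num [h']⟩
  have hpos : ∀ {a : ℝ}, 0 ≤ a → a < 1 → ⌊a⌋ = 0 := fun h h' =>
    Int.floor_eq_zero_iff.2 ⟨h, h'⟩
  obtain ⟨⟨hA, hA'⟩, hB, hB'⟩ := hy
  fin_cases i
  · simp [fold, latticeVec, pieceShift, hpos hi.1 hA', hpos hi.2 hB']
  · simp [fold, latticeVec, pieceShift, hneg hA hi.1, hpos hi.2 hB']
  · simp [fold, latticeVec, pieceShift, hneg hA hi.1, hneg hB hi.2]
  · simp [fold, latticeVec, pieceShift, hpos hi.1 hA', hneg hB hi.2]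

theorem shiftedBoundary_eq_image_fold (hΓ : Γ ⊆ expandedCell e₁ e₂) :
    shiftedBoundary e₁ e₂ Γ = fold e₁ e₂ '' Γ := by
  conv_rhs => rw [← iUnion_piece (e₁ := e₁) (e₂ := e₂) Γ, image_iUnion]
  exact iUnion_congr fun i => image_congr fun y hy => (fold_eq_sub_pieceShift (hΓ hy.1) hy.2).symm

theorem IsShiftedDensity.apply_fold {σ σ' : Plane → Plane} (h : IsShiftedDensity e₁ e₂ Γ σ σ')
    (hΓ : Γ ⊆ expandedCell e₁ e₂) {y : Plane} (hy : y ∈ Γ) : σ' (fold e₁ e₂ y) = σ y := by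
  obtain ⟨i, hi⟩ := mem_iUnion.1 ((iUnion_piece (e₁ := e₁) (e₂ := e₂) Γ).symm ▸ hy)
  rw [fold_eq_sub_pieceShift (hΓ hy) hi.2, h i y hi]

/-- A set that carries the sources: compact, of finite length, contained in the expanded cell and
disjoint from its lattice images. -/
structure IsSourceSet (e₁ e₂ : Plane) (Γ : Set Plane) : Prop where
  isCompact : IsCompact Γ
  hausdorffMeasure_lt_top : μH[1] Γ < ⊤
  subset : Γ ⊆ expandedCell e₁ e₂
  disjoint_images : ∀ m k : ℤ, (m, k) ≠ (0, 0) → ∀ x ∈ Γ, x + latticeVec e₁ e₂ m k ∉ Γ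

theorem IsSmoothClosedCurve.isCompact (h : IsSmoothClosedCurve Γ) : IsCompact Γ := by
  obtain ⟨γ, hγ, hper, -, -, rfl⟩ := h
  rw [← hper.image_Icc one_pos 0]
  exact isCompact_Icc.image hγ.continuous

theorem IsSmoothClosedCurve.hausdorffMeasure_lt_top (h : IsSmoothClosedCurve Γ) :
    μH[1] Γ < ⊤ := by
  obtain ⟨γ, hγ, hper, -, -, rfl⟩ := h
  rw [← hper.image_Icc one_pos 0]
  have hγ₁ : ContDiff ℝ 1 γ := hγ.of_le (mod_cast le_top)
  obtain ⟨K, hK⟩ := hγ₁.locallyLipschitz.locallyLipschitzOn.exists_lipschitzOnWith_of_compact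
    (isCompact_Icc (a := (0 : ℝ)) (b := 0 + 1))
  refine (hK.hausdorffMeasure_image_le zero_le_one).trans_lt ?_
  rw [hausdorffMeasure_real, Real.volume_Icc]
  exact ENNReal.mul_lt_top (ENNReal.rpow_lt_top_of_nonneg zero_le_one ENNReal.coe_ne_top)
    ENNReal.ofReal_lt_top

theorem IsParticle.isSourceSet_frontier {Ω : Set Plane} (h : IsParticle e₁ e₂ Ω) :
    IsSourceSet e₁ e₂ (frontier Ω) where
  isCompact := h.boundary.isCompact
  hausdorffMeasure_lt_top := h.boundary.hausdorffMeasure_lt_top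
  subset := frontier_subset_closure.trans h.subset
  disjoint_images m k hmk x hx hx' :=
    h.disjoint_images m k hmk x (frontier_subset_closure hx) (frontier_subset_closure hx')

namespace IsSourceSet

theorem injOn_fold (h : IsSourceSet e₁ e₂ Γ) : InjOn (fold e₁ e₂) Γ := by
  intro x hx y hy hxy
  obtain ⟨a, -, ha⟩ := exists_fold_eq (h.subset hx)
  obtain ⟨b, -, hb⟩ := exists_fold_eq (h.subset hy)
  have hyx : y = x + latticeVec e₁ e₂ (b.1 - a.1) (b.2 - a.2) := by
    rw [← sub_add_cancel y (latticeVec e₁ e₂ b.1 b.2), ← hb, ← hxy, ha]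
    simp only [latticeVec, Int.cast_sub]
    module
  by_cases hab : (b.1 - a.1, b.2 - a.2) = (0, 0)
  · rw [hyx, (Prod.mk.inj hab).1, (Prod.mk.inj hab).2, latticeVec, Int.cast_zero, zero_smul,
      zero_smul, add_zero, add_zero]
  · exact absurd (hyx ▸ hy) (h.disjoint_images _ _ hab x hx)

theorem pairwise_disjoint_shifted_piece (h : IsSourceSet e₁ e₂ Γ) :
    Pairwise (Function.onFun Disjoint fun i =>
      (fun y => y - pieceShift e₁ e₂ i) '' piece e₁ e₂ Γ i) := by
  refine fun i j hij => Set.disjoint_left.2 ?_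
  rintro _ ⟨x, hx, rfl⟩ ⟨y, hy, heq⟩
  have hxy : x = y := h.injOn_fold hx.1 hy.1 <| by
    rw [fold_eq_sub_pieceShift (h.subset hx.1) hx.2,
      fold_eq_sub_pieceShift (h.subset hy.1) hy.2]
    exact heq.symm
  exact Set.disjoint_left.1 (pairwise_disjoint_piece Γ hij) hx (hxy ▸ hy)

theorem setIntegral_shiftedBoundary (h : IsSourceSet e₁ e₂ Γ) {E : Type*} [NormedAddCommGroup E]
    [NormedSpace ℝ E] {g : Plane → E} (hg : IntegrableOn (fun y => g (fold e₁ e₂ y)) Γ μH[1]) :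
    ∫ z in shiftedBoundary e₁ e₂ Γ, g z ∂μH[1] = ∫ y in Γ, g (fold e₁ e₂ y) ∂μH[1] := by
  have hmeas : ∀ i, MeasurableSet (piece e₁ e₂ Γ i) := fun i =>
    h.isCompact.measurableSet.inter (measurableSet_quadrant i)
  have hmp : ∀ i, MeasurePreserving (fun y : Plane => y - pieceShift e₁ e₂ i) μH[1] μH[1] :=
    fun i => (IsometryEquiv.subRight _).measurePreserving_hausdorffMeasure 1
  have hemb : ∀ i, MeasurableEmbedding fun y : Plane => y - pieceShift e₁ e₂ i :=
    fun i => (MeasurableEquiv.subRight _).measurableEmbedding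
  have hfold : ∀ i, EqOn (fun y => g (fold e₁ e₂ y)) (fun y => g (y - pieceShift e₁ e₂ i))
      (piece e₁ e₂ Γ i) := fun i y hy =>
    congrArg g (fold_eq_sub_pieceShift (h.subset hy.1) hy.2)
  have hint : ∀ i, IntegrableOn (fun y => g (fold e₁ e₂ y)) (piece e₁ e₂ Γ i) μH[1] :=
    fun i => hg.mono_set inter_subset_left
  calc ∫ z in shiftedBoundary e₁ e₂ Γ, g z ∂μH[1]
      = ∑ i, ∫ z in (fun y => y - pieceShift e₁ e₂ i) '' piece e₁ e₂ Γ i, g z ∂μH[1] :=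
        integral_iUnion_fintype (fun i => (hemb i).measurableSet_image.2 (hmeas i))
          h.pairwise_disjoint_shifted_piece fun i =>
            ((hmp i).integrableOn_image (hemb i)).2 ((hint i).congr_fun (hfold i) (hmeas i))
    _ = ∑ i, ∫ y in piece e₁ e₂ Γ i, g (fold e₁ e₂ y) ∂μH[1] :=
        Finset.sum_congr rfl fun i _ => by
          rw [(hmp i).setIntegral_image_emb (hemb i), setIntegral_congr_fun (hmeas i) (hfold i)]
    _ = ∫ y in Γ, g (fold e₁ e₂ y) ∂μH[1] := by
        rw [← integral_iUnion_fintype hmeas (pairwise_disjoint_piece Γ) hint, iUnion_piece]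

end IsSourceSet

/-! ### Separation of sources and targets -/

theorem exists_le_norm_of_half_le_max (e₁ e₂ : Plane) : ∃ δ > 0, ∀ r : Plane,
    1 / 2 ≤ max |coordA e₁ e₂ r| |coordB e₁ e₂ r| → δ ≤ ‖r‖ := by
  set M := max ‖coordAL e₁ e₂‖ ‖coordBL e₁ e₂‖ + 1
  have hM : 0 < M := by positivity
  refine ⟨1 / 2 / M, by positivity, fun r hr => (div_le_iff₀' hM).2 (hr.trans (max_le ?_ ?_))⟩
  · exact (coordAL e₁ e₂).le_of_opNorm_le
      ((le_max_left _ _).trans (le_add_of_nonneg_right zero_le_one)) r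
  · exact (coordBL e₁ e₂).le_of_opNorm_le
      ((le_max_right _ _).trans (le_add_of_nonneg_right zero_le_one)) r

theorem half_le_max_of_mem_shiftedWalls (he : cross e₁ e₂ ≠ 0) {b : ℝ → Plane}
    (hb : b ∈ shiftedWalls e₁ e₂) {t : ℝ} {z : Plane} (hz : z ∈ lowerLeftCell e₁ e₂) :
    1 / 2 ≤ max |coordA e₁ e₂ (b t - z)| |coordB e₁ e₂ (b t - z)| := by
  rcases coord_sub_of_mem_shiftedWalls he hb (t := t) hz with h | h | h
  · exact le_max_of_le_left (le_abs.2 (Or.inl h))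
  · exact le_max_of_le_left (le_abs.2 (Or.inr (le_neg_of_le_neg h)))
  · exact le_max_of_le_right (le_abs.2 (Or.inr (le_neg_of_le_neg h)))

theorem isAwayFrom_of_mem_shiftedWalls (he : cross e₁ e₂ ≠ 0) {b : ℝ → Plane}
    (hb : b ∈ shiftedWalls e₁ e₂) (ν : Measure Plane) : IsAwayFrom ν (fold e₁ e₂) b := by
  obtain ⟨δ, hδ, h⟩ := exists_le_norm_of_half_le_max e₁ e₂
  exact ⟨δ, hδ, Eventually.of_forall fun y t _ =>
    h _ (half_le_max_of_mem_shiftedWalls he hb (fold_mem_lowerLeftCell he y))⟩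

theorem IsAwayFrom.of_isCompact {α : Type*} [MeasurableSpace α] {ν : Measure α} {φ : α → Plane}
    {c : ℝ → Plane} {K : Set Plane} (hc : ContinuousOn c (Icc 0 1)) (hK : IsCompact K)
    (hcK : ∀ t ∈ Icc (0 : ℝ) 1, c t ∉ K) (hφ : ∀ᵐ y ∂ν, φ y ∈ K) : IsAwayFrom ν φ c := by
  have hcont : ContinuousOn (fun p : ℝ × Plane => ‖c p.1 - p.2‖) (Icc 0 1 ×ˢ K) :=
    ((hc.comp continuousOn_fst fun p hp => hp.1).sub continuousOn_snd).norm
  obtain ⟨δ, hδ, h⟩ := (isCompact_Icc.prod hK).exists_forall_le' hcont (a := 0) fun p hp =>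
    norm_pos_iff.2 (sub_ne_zero.2 fun heq => hcK p.1 hp.1 (heq ▸ hp.2))
  exact ⟨δ, hδ, hφ.mono fun y hy t ht => h (t, φ y) ⟨ht, hy⟩⟩

theorem IsDeformedBottomWall.add_latticeVec_ne {c : ℝ → Plane}
    (h : IsDeformedBottomWall e₁ e₂ Γ c) {y : Plane} (hy : y ∈ Γ) (m k : ℤ) {t : ℝ}
    (ht : t ∈ Icc (0 : ℝ) 1) : y + latticeVec e₁ e₂ m k ≠ c t := by
  have hmem : c t ∈ periodicCurve e₁ c := ⟨0, t, ht, by simp⟩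
  intro heq
  rcases le_or_gt 0 k with hk | hk
  · obtain ⟨_, hjoin, -⟩ := h.liesAbove (subset_closure hy) m hk
    exact hjoin.source_mem (heq ▸ hmem)
  · obtain ⟨_, hjoin, -⟩ := h.liesBelow (subset_closure hy) m hk
    exact hjoin.source_mem (heq ▸ hmem)

theorem IsDeformedBottomWall.isAwayFrom_fold_add {c : ℝ → Plane}
    (h : IsDeformedBottomWall e₁ e₂ Γ c) (hΓ : IsSourceSet e₁ e₂ Γ) (j : ℤ × ℤ) :
    IsAwayFrom (μH[1].restrict Γ) (fun y => fold e₁ e₂ y + latticeVec e₁ e₂ j.1 j.2) c := by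
  have himage : ∀ a : ℤ × ℤ, IsCompact ((· + latticeVec e₁ e₂ (j.1 - a.1) (j.2 - a.2)) '' Γ) :=
    fun a => hΓ.isCompact.image (continuous_add_const _)
  refine .of_isCompact h.piecewiseC1.1 (unitSquare.isCompact_biUnion fun a _ => himage a) ?_ ?_
  · intro t ht hmem
    obtain ⟨a, -, y, hy, heq⟩ := mem_iUnion₂.1 hmem
    exact h.add_latticeVec_ne hy _ _ ht heq
  · refine ae_restrict_of_forall_mem hΓ.isCompact.measurableSet fun y hy => ?_
    obtain ⟨a, ha, hfold⟩ := exists_fold_eq (hΓ.subset hy)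
    refine mem_iUnion₂.2 ⟨a, ha, y, hy, ?_⟩
    simp only [hfold, latticeVec, Int.cast_sub]
    module

end

/-! ### The near traction along the deformed wall -/

section

variable {e₁ e₂ : Plane} {Γ : Set Plane} {σ : Plane → Plane}

theorem singleLayerTraction_smul (Γ : Set Plane) (σ : Plane → Plane) (x : Plane) (a : ℝ)
    (n : Plane) : singleLayerTraction Γ σ x (a • n) = a • singleLayerTraction Γ σ x n := by
  simp only [singleLayerTraction, tractionKernel_smul, integral_smul]

theorem periodicTraction_smul (μ : ℝ) (e₁ e₂ : Plane) (Γ : Set Plane) (σ v : Plane → Plane)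
    (q : Plane → ℝ) (x : Plane) (a : ℝ) (n : Plane) :
    periodicTraction μ e₁ e₂ Γ σ v q x (a • n) = a • periodicTraction μ e₁ e₂ Γ σ v q x n := by
  simp only [periodicTraction, nearTraction, nearSum, tractionKernel_smul, ← smul_finsum,
    integral_smul, traction_smul, smul_add]

theorem integral_shiftedWallSum {α : Type*} [MeasurableSpace α] {ν : Measure α}
    {I : (ℝ → Plane) → α → Plane} (h : ∀ b ∈ shiftedWalls e₁ e₂, Integrable (I b) ν) :
    ∫ y, shiftedWallSum e₁ e₂ (fun b => I b y) ∂ν =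
      shiftedWallSum e₁ e₂ fun b => ∫ y, I b y ∂ν := by
  simp only [shiftedWalls, mem_insert_iff, mem_singleton_iff, forall_eq_or_imp, forall_eq] at h
  obtain ⟨hR, hL, hD₁, hD₂⟩ := h
  simp only [shiftedWallSum]
  rw [integral_add, integral_add, integral_sub, integral_smul, integral_smul]
  exacts [hR, hL, hR.sub hL, hD₁.smul (2 : ℝ), (hR.sub hL).add (hD₁.smul (2 : ℝ)),
    hD₂.smul (2 : ℝ)]

theorem integrable_shiftedWallSum {α : Type*} [MeasurableSpace α] {ν : Measure α}
    {I : (ℝ → Plane) → α → Plane} (h : ∀ b ∈ shiftedWalls e₁ e₂, Integrable (I b) ν) :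
    Integrable (fun y => shiftedWallSum e₁ e₂ fun b => I b y) ν := by
  simp only [shiftedWalls, mem_insert_iff, mem_singleton_iff, forall_eq_or_imp, forall_eq] at h
  obtain ⟨hR, hL, hD₁, hD₂⟩ := h
  exact ((hR.sub hL).add (hD₁.smul (2 : ℝ))).add (hD₂.smul (2 : ℝ))

namespace IsSourceSet

theorem isFiniteMeasure_restrict (h : IsSourceSet e₁ e₂ Γ) :
    IsFiniteMeasure (μH[1].restrict Γ : Measure Plane) :=
  MeasureTheory.isFiniteMeasure_restrict.2 h.hausdorffMeasure_lt_top.ne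

theorem tractionIntegral_singleLayerTraction (h : IsSourceSet e₁ e₂ Γ)
    (hσ : IntegrableOn σ Γ μH[1]) {σ' : Plane → Plane} (hσ' : IsShiftedDensity e₁ e₂ Γ σ σ')
    {b : ℝ → Plane} (hb : IsRectifiableCurve b)
    (hbΓ : IsAwayFrom (μH[1].restrict Γ) (fold e₁ e₂) b) :
    tractionIntegral b (singleLayerTraction (shiftedBoundary e₁ e₂ Γ) σ') =
      ∫ y in Γ, kernelIntegral b (fold e₁ e₂ y) (σ y) ∂μH[1] := by
  have := h.isFiniteMeasure_restrict
  have hfold := (measurable_fold (e₁ := e₁) (e₂ := e₂)).aemeasurable (μ := μH[1].restrict Γ)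
  have hdensity : ∀ x n, EqOn (fun y => tractionKernel x n (fold e₁ e₂ y) (σ y))
      (fun y => tractionKernel x n (fold e₁ e₂ y) (σ' (fold e₁ e₂ y))) Γ := fun x n y hy =>
    congrArg _ (hσ'.apply_fold h.subset hy).symm
  rw [tractionIntegral_eq_integral_perp_deriv b (singleLayerTraction_smul _ _),
    ← hbΓ.integral_integral_tractionKernel hfold hσ hb]
  refine intervalIntegral.integral_congr fun t ht => ?_
  rw [uIcc_of_le zero_le_one] at ht
  have hint := hbΓ.integrable_tractionKernel hfold hσ ht (perp (deriv b t))
  exact (h.setIntegral_shiftedBoundary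
    (g := fun z => tractionKernel (b t) (perp (deriv b t)) z (σ' z))
    (IntegrableOn.congr_fun hint (hdensity _ _) h.isCompact.measurableSet)).trans
      (setIntegral_congr_fun h.isCompact.measurableSet (hdensity _ _).symm)

end IsSourceSet

namespace IsDeformedBottomWall

variable {c : ℝ → Plane}

theorem nearTraction_eq_sum (h : IsDeformedBottomWall e₁ e₂ Γ c) (he : cross e₁ e₂ ≠ 0)
    (hΓ : IsSourceSet e₁ e₂ Γ) (hσ : IntegrableOn σ Γ μH[1]) {t : ℝ} (ht : t ∈ Icc (0 : ℝ) 1)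
    (n : Plane) :
    nearTraction e₁ e₂ Γ σ (c t) n = ∑ j ∈ unitSquare,
      ∫ y in Γ, tractionKernel (c t) n (fold e₁ e₂ y + latticeVec e₁ e₂ j.1 j.2) (σ y) ∂μH[1] := by
  simp only [nearTraction, nearSum_eq_sum_fold he]
  exact integral_finsetSum _ fun j _ => (h.isAwayFrom_fold_add hΓ j).integrable_tractionKernel
    (measurable_fold.add_const _).aemeasurable hσ ht n

theorem intervalIntegrable_nearTraction (h : IsDeformedBottomWall e₁ e₂ Γ c)
    (he : cross e₁ e₂ ≠ 0) (hΓ : IsSourceSet e₁ e₂ Γ) (hσ : IntegrableOn σ Γ μH[1]) :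
    IntervalIntegrable (fun t => nearTraction e₁ e₂ Γ σ (c t) (perp (deriv c t))) volume 0 1 := by
  have := hΓ.isFiniteMeasure_restrict
  refine (IntervalIntegrable.sum unitSquare fun j _ =>
    (h.isAwayFrom_fold_add hΓ j).intervalIntegrable_integral
      (measurable_fold.add_const _).aemeasurable hσ (.of_isPiecewiseC1 h.piecewiseC1)).congr ?_
  intro t ht
  rw [uIoc_of_le zero_le_one] at ht
  simp only [Finset.sum_apply, h.nearTraction_eq_sum he hΓ hσ (Ioc_subset_Icc_self ht)]

theorem integral_nearTraction (h : IsDeformedBottomWall e₁ e₂ Γ c)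
    (he : cross e₁ e₂ ≠ 0) (hΓ : IsSourceSet e₁ e₂ Γ) (hσ : IntegrableOn σ Γ μH[1]) :
    ∫ t in (0 : ℝ)..1, nearTraction e₁ e₂ Γ σ (c t) (perp (deriv c t)) =
      ∫ y in Γ, ∑ j ∈ unitSquare,
        kernelIntegral c (fold e₁ e₂ y + latticeVec e₁ e₂ j.1 j.2) (σ y) ∂μH[1] := by
  have := hΓ.isFiniteMeasure_restrict
  have hc := IsRectifiableCurve.of_isPiecewiseC1 h.piecewiseC1
  have hfold : ∀ j : ℤ × ℤ, AEMeasurable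
      (fun y => fold e₁ e₂ y + latticeVec e₁ e₂ j.1 j.2) (μH[1].restrict Γ) :=
    fun j => (measurable_fold.add_const _).aemeasurable
  have haway := h.isAwayFrom_fold_add hΓ
  rw [integral_finsetSum _ fun j _ => (haway j).integrable_kernelIntegral (hfold j) hσ hc,
    ← Finset.sum_congr rfl fun j _ => (haway j).integral_integral_tractionKernel (hfold j) hσ hc,
    ← intervalIntegral.integral_finsetSum fun j _ =>
      (haway j).intervalIntegrable_integral (hfold j) hσ hc]
  refine intervalIntegral.integral_congr fun t ht => ?_
  rw [uIcc_of_le zero_le_one] at ht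
  exact h.nearTraction_eq_sum he hΓ hσ ht _

theorem integral_nearTraction_eq_shiftedWallSum (h : IsDeformedBottomWall e₁ e₂ Γ c)
    (he : 0 < cross e₁ e₂) (hΓ : IsSourceSet e₁ e₂ Γ) (hσ : IntegrableOn σ Γ μH[1])
    (hcA : ∀ t ∈ Icc (0 : ℝ) 1, coordA e₁ e₂ (c t) ∈ Ico (-1 : ℝ) 1)
    {σ' : Plane → Plane} (hσ' : IsShiftedDensity e₁ e₂ Γ σ σ') :
    ∫ t in (0 : ℝ)..1, nearTraction e₁ e₂ Γ σ (c t) (perp (deriv c t)) =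
      shiftedWallSum e₁ e₂
          (fun b => tractionIntegral b (singleLayerTraction (shiftedBoundary e₁ e₂ Γ) σ')) -
        netForce (piece e₁ e₂ Γ 0 ∪ piece e₁ e₂ Γ 1) σ := by
  have := hΓ.isFiniteMeasure_restrict
  have hwall : ∀ b ∈ shiftedWalls e₁ e₂,
      Integrable (fun y => kernelIntegral b (fold e₁ e₂ y) (σ y)) (μH[1].restrict Γ) :=
    fun b hb => (isAwayFrom_of_mem_shiftedWalls he.ne' hb _).integrable_kernelIntegral
      measurable_fold.aemeasurable hσ (isRectifiableCurve_of_mem_shiftedWalls hb)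
  calc ∫ t in (0 : ℝ)..1, nearTraction e₁ e₂ Γ σ (c t) (perp (deriv c t))
      = ∫ y in Γ, ∑ j ∈ unitSquare,
          kernelIntegral c (fold e₁ e₂ y + latticeVec e₁ e₂ j.1 j.2) (σ y) ∂μH[1] :=
        h.integral_nearTraction he.ne' hΓ hσ
    _ = ∫ y in Γ, (shiftedWallSum e₁ e₂ (fun b => kernelIntegral b (fold e₁ e₂ y) (σ y)) -
          {x | 0 ≤ coordB e₁ e₂ x}.indicator σ y) ∂μH[1] :=
        setIntegral_congr_fun hΓ.isCompact.measurableSet fun y hy =>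
          h.sum_kernelIntegral_fold he hΓ.subset hcA σ hy
    _ = shiftedWallSum e₁ e₂ (fun b => ∫ y in Γ, kernelIntegral b (fold e₁ e₂ y) (σ y) ∂μH[1]) -
          netForce (piece e₁ e₂ Γ 0 ∪ piece e₁ e₂ Γ 1) σ := by
        rw [integral_sub (integrable_shiftedWallSum hwall)
          (hσ.indicator measurableSet_nonneg_coordB), integral_shiftedWallSum hwall,
          netForce_upper_pieces]
    _ = _ := by
        rw [shiftedWallSum_congr fun b hb => hΓ.tractionIntegral_singleLayerTraction hσ hσ'
          (isRectifiableCurve_of_mem_shiftedWalls hb) (isAwayFrom_of_mem_shiftedWalls he.ne' hb _)]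

end IsDeformedBottomWall

theorem wallD_mem_cell (he : cross e₁ e₂ ≠ 0) {t : ℝ} (ht : t ∈ Icc (0 : ℝ) 1) :
    wallD e₁ e₂ t ∈ cell e₁ e₂ := by
  simp only [cell, mem_ofPred_eq, wallD, seg, coordA_add, coordB_add, coordA_smul, coordB_smul,
    coordA_corner he, coordB_corner he, coordA_e₁ he, coordB_e₁]
  exact ⟨abs_le.2 ⟨by linarith [ht.1], by linarith [ht.2]⟩, abs_le.2 ⟨by linarith, by linarith⟩⟩

theorem IsSourceSet.integrableOn_of_continuousOn (h : IsSourceSet e₁ e₂ Γ)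
    (hσ : ContinuousOn σ Γ) : IntegrableOn σ Γ μH[1] := by
  obtain ⟨M, hM⟩ := h.isCompact.exists_bound_of_continuousOn hσ
  exact .of_bound h.hausdorffMeasure_lt_top (hσ.aestronglyMeasurable h.isCompact.measurableSet)
    M (ae_restrict_of_forall_mem h.isCompact.measurableSet hM)

end

end StokesCell

end

theorem mainTheorem6_general (μ : ℝ) {e₁ e₂ : Plane} (he : 0 < cross e₁ e₂)
    {Γ : Set Plane} (hΓ : IsSourceSet e₁ e₂ Γ)
    {σ : Plane → Plane} (hσ : IntegrableOn σ Γ μH[1])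
    {W : Set Plane} (hWo : IsOpen W) (hWc : Convex ℝ W)
    (hDW : ∀ t ∈ Icc (0 : ℝ) 1, wallD e₁ e₂ t ∈ W)
    {v : Plane → Plane} {q : Plane → ℝ} (hvq : IsStokesPair μ W v q)
    {c : ℝ → Plane} (hc : IsDeformedBottomWall e₁ e₂ Γ c)
    (hcW : ∀ t ∈ Icc (0 : ℝ) 1, c t ∈ W)
    (hcA : ∀ t ∈ Icc (0 : ℝ) 1, coordA e₁ e₂ (c t) ∈ Ico (-1 : ℝ) 1)
    {σ' : Plane → Plane} (hσ' : IsShiftedDensity e₁ e₂ Γ σ σ') :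
    (tractionIntegral c (periodicTraction μ e₁ e₂ Γ σ v q) =
      shiftedWallSum e₁ e₂
          (fun b => tractionIntegral b (singleLayerTraction (shiftedBoundary e₁ e₂ Γ) σ'))
        - netForce (piece e₁ e₂ Γ 0 ∪ piece e₁ e₂ Γ 1) σ
        + tractionIntegral (wallD e₁ e₂) (traction μ v q)) ∧
    (∀ b ∈ shiftedWalls e₁ e₂, ∀ t, ∀ y ∈ shiftedBoundary e₁ e₂ Γ,
      1 / 2 ≤ max |coordA e₁ e₂ (b t - y)| |coordB e₁ e₂ (b t - y)|) := by
  have hcurve := IsRectifiableCurve.of_isPiecewiseC1 hc.piecewiseC1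
  have hwall : IsRectifiableCurve (wallD e₁ e₂) := .segment _ _
  constructor
  · rw [tractionIntegral_eq_integral_perp_deriv c (periodicTraction_smul μ e₁ e₂ Γ σ v q),
      tractionIntegral_eq_integral_perp_deriv (wallD e₁ e₂) (traction_smul μ v q),
      ← hc.integral_nearTraction_eq_shiftedWallSum he hΓ hσ hcA hσ',
      ← hvq.integral_traction_eq_of_endpoints_eq hWo hWc hcurve hcW hwall hDW
        hc.start hc.finish]
    exact intervalIntegral.integral_add (hc.intervalIntegrable_nearTraction he.ne' hΓ hσ)
      (hvq.intervalIntegrable_traction hWo hcurve hcW)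
  · rintro b hb t y hy
    obtain ⟨x, -, rfl⟩ := shiftedBoundary_eq_image_fold hΓ.subset ▸ hy
    exact half_le_max_of_mem_shiftedWalls he.ne' hb (fold_mem_lowerLeftCell he.ne' x)

theorem mainTheorem6 (μ : ℝ) (hμ : 0 < μ) (e₁ e₂ : Plane) (he : 0 < cross e₁ e₂)
    (Ω : Set Plane) (hΩ : IsParticle e₁ e₂ Ω) (Γ : Set Plane) (hΓ : Γ = frontier Ω)
    (σ : Plane → Plane) (hσ : ContinuousOn σ Γ)
    (W : Set Plane) (hWo : IsOpen W) (hWc : Convex ℝ W)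
    (hUW : cell e₁ e₂ ⊆ W) (hWU : W ⊆ expandedCell e₁ e₂)
    (v : Plane → Plane) (q : Plane → ℝ) (hvq : IsCorrectionPair μ e₁ e₂ Γ σ W v q)
    (c : ℝ → Plane) (hc : IsDeformedBottomWall e₁ e₂ Ω c)
    (hcW : ∀ t ∈ Set.Icc (0 : ℝ) 1, c t ∈ W)
    (Γ' : Set Plane) (hΓ' : Γ' = shiftedBoundary e₁ e₂ Γ)
    (σ' : Plane → Plane) (hσ' : IsShiftedDensity e₁ e₂ Γ σ σ') :
    (tractionIntegral c (periodicTraction μ e₁ e₂ Γ σ v q) =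
      tractionIntegral (shiftCurve (wallR e₁ e₂) e₂) (singleLayerTraction Γ' σ')
      - tractionIntegral (shiftCurve (wallL e₁ e₂) (e₁ + e₂)) (singleLayerTraction Γ' σ')
      + (2 : ℝ) • tractionIntegral (shiftCurve (wallD e₁ e₂) (e₁ + e₂)) (singleLayerTraction Γ' σ')
      + (2 : ℝ) • tractionIntegral (shiftCurve (wallD e₁ e₂) e₂) (singleLayerTraction Γ' σ')
      - netForce (piece e₁ e₂ Γ 0 ∪ piece e₁ e₂ Γ 1) σ
      + tractionIntegral (wallD e₁ e₂) (traction μ v q)) ∧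
    (∀ b ∈ ({shiftCurve (wallR e₁ e₂) e₂, shiftCurve (wallL e₁ e₂) (e₁ + e₂),
        shiftCurve (wallD e₁ e₂) (e₁ + e₂), shiftCurve (wallD e₁ e₂) e₂} : Set (ℝ → Plane)),
      ∀ t ∈ Set.Icc (0 : ℝ) 1, ∀ y ∈ Γ',
        1 / 2 ≤ max |coordA e₁ e₂ (b t - y)| |coordB e₁ e₂ (b t - y)|) := by
  subst hΓ hΓ'
  exact (mainTheorem6_general μ he hΩ.isSourceSet_frontier
    (hΩ.isSourceSet_frontier.integrableOn_of_continuousOn hσ) hWo hWc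
    (fun t ht => hUW (wallD_mem_cell he.ne' ht)) hvq.stokes
    (hc.mono (closure_minimal frontier_subset_closure isClosed_closure)) hcW
    (fun t ht => (hWU (hcW t ht)).1) hσ').imp_right fun hsep b hb t _ => hsep b hb t
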